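/- Let $S$ be a closed connected oriented surface of genus at least two, with universal cover $\tilde S$, on which $\pi_1(S)$ acts by deck transformations. A $\mathbb{CP}^1$-structure on $S$ is given by a pair $(f,\rho)$ of a local homeomorphism $f\colon\tilde S\to\mathbb{CP}^1$ (the developing map) and a homomorphism $\rho\colon\pi_1(S)\to\mathrm{PSL}(2,\mathbb C)$ (the holonomy representation) such that $f$ is $\rho$-equivariant. Let $\mathsf P$ be the deformation space of marked $\mathbb{CP}^1$-structures on $S$: such pairs, with the topology of uniform convergence of $f$ on compact sets and convergence of $\rho$, modulo $(f,\rho)\sim(Af,A\rho A^{-1})$ for $A\in\mathrm{PSL}(2,\mathbb C)$ and modulo isotopy of $S$, with the quotient topology. Let $\mathcal R=\mathrm{Hom}(\pi_1(S),\mathrm{PSL}(2,\mathbb C))$ be the representation variety, with the topology of pointwise convergence (equivalently, the topology induced from $\mathrm{PSL}(2,\mathbb C)^n$ by evaluation at a generating set $\gamma_1,\dots,\gamma_n$), and let $\chi=\mathcal R/\!\!/\mathrm{PSL}(2,\mathbb C)$ be the character variety, i.e. the GIT quotient of $\mathcal R$ by conjugation: its points are the classes $[\rho]$ for the relation $\rho_1\sim\rho_2$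 if and only if the closures in $\mathcal R$ of the conjugation orbits of $\rho_1$ and $\rho_2$ intersect, and its topology is the quotient topology. The holonomy map $\mathrm{Hol}\colon\mathsf P\to\chi$ sends the class of $(f,\rho)$ to $[\rho]$. Proposition. Let $C_t$ $(t\ge 0)$ be a continuous path in $\mathsf P$ whose holonomy $\eta_t=\mathrm{Hol}(C_t)\in\chi$ converges to some $\eta_\infty\in\chi$ as $t\to\infty$. Then there are a continuous path $\rho_t$ $(t\ge 0)$ in $\mathcal R$ and $\rho_\infty\in\mathcal R$ such that $[\rho_t]=\eta_t$ for all $t\ge 0$, $\rho_t\to\rho_\infty$ in $\mathcal R$ as $t\to\infty$, and $[\rho_\infty]=\eta_\infty$. (Nothing is assumed about $\eta_\infty$: it may be elementary, or even the class of the trivial representation.) -/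

import Mathlib

open Filter Topology
open scoped Manifold ContDiff NNReal unitInterval LinearAlgebra.Projectivization

namespace NeckPinching

noncomputable section

/-! ### Closed oriented surfaces -/

/-- The atlas of a smooth surface is oriented: all coordinate changes have positive Jacobian
determinant. -/
def IsOrientedAtlas (S : Type*) [TopologicalSpace S]
    [ChartedSpace (EuclideanSpace ℝ (Fin 2)) S] : Prop :=
  ∀ e ∈ atlas (EuclideanSpace ℝ (Fin 2)) S, ∀ e' ∈ atlas (EuclideanSpace ℝ (Fin 2)) S,
    ∀ x ∈ (e.symm.trans e').source, 0 < (fderiv ℝ (e.symm.trans e') x).det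

/-- A closed connected oriented surface has genus `g` if its first Betti number, that is, the rank
of the abelianization of its fundamental group, equals `2 * g`. -/
def HasGenus (S : Type*) [TopologicalSpace S] (g : ℕ) : Prop :=
  ∀ x : S, Module.finrank ℤ (Additive (Abelianization (FundamentalGroup S x))) = 2 * g

/-- The group of deck transformations of `p`. When `p` is the universal covering of `S`, this is
the fundamental group of `S` together with its action on the universal cover. -/
def DeckGroup {S E : Type*} [TopologicalSpace E] (p : E → S) : Subgroup (E ≃ₜ E) where
  carrier := {h | ∀ x, p (h x) = p x}
  mul_mem' {a b} ha hb x := by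
    change p (a (b x)) = p x
    rw [ha, hb]
  one_mem' _ := rfl
  inv_mem' {a} ha x := by
    have h := ha (a.symm x)
    rw [Homeomorph.apply_symm_apply] at h
    exact h.symm

/-! ### `PSL(2, ℂ)` and the complex projective line -/

/-- The group `PSL(2, ℂ)`, with the quotient topology of `SL(2, ℂ)`. -/
abbrev PSL2C : Type := Matrix.ProjectiveSpecialLinearGroup (Fin 2) ℂ

/-- The complex projective line, on which `PSL(2, ℂ)` acts by projective transformations. -/
abbrev CP1 : Type := ℙ ℂ (Fin 2 → ℂ)

/-- The complex projective line carries the quotient topology of `ℂ² ∖ {0}`. -/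
instance : TopologicalSpace CP1 :=
  TopologicalSpace.coinduced
    (fun v : {v : Fin 2 → ℂ // v ≠ 0} => Projectivization.mk ℂ v.1 v.2) inferInstance

/-! ### Representation variety and character variety -/

/-- The `PSL(2, ℂ)`-representation variety of a group. -/
abbrev RepresentationVariety (Γ : Type*) [Group Γ] : Type _ := Γ →* PSL2C

/-- The topology of pointwise convergence. If `γ₁, …, γₙ` generate `Γ`, it is the one induced by
the embedding `ρ ↦ (ρ γ₁, …, ρ γₙ)` into `PSL(2, ℂ)ⁿ`. -/
instance (Γ : Type*) [Group Γ] : TopologicalSpace (RepresentationVariety Γ) :=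
  TopologicalSpace.induced (fun ρ γ => ρ γ) inferInstance

/-- The conjugation action of `PSL(2, ℂ)` on representations. -/
def conjRep {Γ : Type*} [Group Γ] (A : PSL2C) (ρ : RepresentationVariety Γ) :
    RepresentationVariety Γ :=
  (MulAut.conj A).toMonoidHom.comp ρ

/-- The orbit of a representation under conjugation. -/
def conjOrbit {Γ : Type*} [Group Γ] (ρ : RepresentationVariety Γ) :
    Set (RepresentationVariety Γ) :=
  Set.range fun A : PSL2C => conjRep A ρ

/-- Extended orbit equivalence: the closures of the two orbits intersect. -/
def ExtendedOrbitEquiv {Γ : Type*} [Group Γ] (ρ₁ ρ₂ : RepresentationVariety Γ) : Prop :=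
  (closure (conjOrbit ρ₁) ∩ closure (conjOrbit ρ₂)).Nonempty

/-- The `PSL(2, ℂ)`-character variety: the GIT quotient of the representation variety by
conjugation, as a topological space. Its points are the extended orbit equivalence classes, and its
topology is the quotient topology. -/
def CharacterVariety (Γ : Type*) [Group Γ] : Type _ :=
  Quot (ExtendedOrbitEquiv (Γ := Γ))

instance (Γ : Type*) [Group Γ] : TopologicalSpace (CharacterVariety Γ) :=
  inferInstanceAs (TopologicalSpace (Quot (ExtendedOrbitEquiv (Γ := Γ))))

/-- The quotient map `ρ ↦ [ρ]` from the representation variety to the character variety. -/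
def toCharacterVariety {Γ : Type*} [Group Γ] (ρ : RepresentationVariety Γ) :
    CharacterVariety Γ :=
  Quot.mk _ ρ

/-! ### Complex projective structures -/

section ProjectiveStructures

variable {S E : Type*} [TopologicalSpace E]

/-- A `ℂP¹`-structure on `S`, given on the universal cover `p : E → S` by its developing map and
its holonomy representation. -/
structure DevelopingPair (p : E → S) where
  /-- the developing map -/
  dev : C(E, CP1)
  /-- the holonomy representation -/
  hol : RepresentationVariety (DeckGroup p)
  isLocalHomeomorph : IsLocalHomeomorph dev
  equivariant : ∀ (γ : DeckGroup p) (x : E), dev ((γ : E ≃ₜ E) x) = hol γ • dev x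

/-- Convergence of developing pairs: the developing maps converge uniformly on compact subsets and
the holonomy representations converge. -/
instance (p : E → S) : TopologicalSpace (DevelopingPair p) :=
  TopologicalSpace.induced (fun C => (C.dev, C.hol)) inferInstance

/-- `φ` is the end of an isotopy starting at the identity through homeomorphisms of the universal
cover that commute with the deck group; equivalently, `φ` is the lift of a self-homeomorphism of `S`
isotopic to the identity, along a lift of the isotopy that starts at the identity. -/
def IsLiftOfIsotopyFromId (p : E → S) (φ : E ≃ₜ E) : Prop :=
  ∃ Φ : I → (E ≃ₜ E), Continuous (fun q : I × E => Φ q.1 q.2) ∧ Φ 0 = 1 ∧ Φ 1 = φ ∧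
    ∀ (s : I) (γ : DeckGroup p) (x : E), Φ s ((γ : E ≃ₜ E) x) = (γ : E ≃ₜ E) (Φ s x)

/-- Two developing pairs define the same marked `ℂP¹`-structure: they differ by the action
`(f, ρ) ↦ (A f, A ρ A⁻¹)` of `PSL(2, ℂ)` and by an isotopy of the surface. -/
def DevelopingPair.Equiv {p : E → S} (C C' : DevelopingPair p) : Prop :=
  ∃ (A : PSL2C) (φ : E ≃ₜ E), IsLiftOfIsotopyFromId p φ ∧
    (∀ x, C'.dev x = A • C.dev (φ x)) ∧ C'.hol = conjRep A C.hol

/-- The deformation space of marked `ℂP¹`-structures, with the quotient topology. -/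
def DeformationSpace (p : E → S) : Type _ :=
  Quot (DevelopingPair.Equiv (p := p))

instance (p : E → S) : TopologicalSpace (DeformationSpace p) :=
  inferInstanceAs (TopologicalSpace (Quot (DevelopingPair.Equiv (p := p))))

theorem conjRep_one {Γ : Type*} [Group Γ] (ρ : RepresentationVariety Γ) : conjRep 1 ρ = ρ := by
  ext γ
  simp [conjRep]

/-- The holonomy map from the deformation space to the character variety. -/
def holonomy {p : E → S} : DeformationSpace p → CharacterVariety (DeckGroup p) :=
  Quot.lift (fun C => toCharacterVariety C.hol) (by
    rintro C C' ⟨A, φ, -, -, h⟩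
    refine Quot.sound ⟨C'.hol, subset_closure ⟨A, h.symm⟩, subset_closure ⟨1, conjRep_one _⟩⟩)

end ProjectiveStructures

end

end NeckPinching

/-!
By Kempf and Ness, a tuple `A` of elements of `SL(2, ℂ)` which minimizes the energy `∑ i, ‖A i‖ ^ 2`
on the closure of its conjugation orbit is determined by that closure up to conjugation by `SU(2)`.
Choosing generators of the deck group `Γ` and lifting matrices from `PSL(2, ℂ)` to `SL(2, ℂ)`, the
character variety of `Γ` becomes the quotient of a closed set of minimal tuples by `SU(2)` and by
changes of signs, and a path in it can be lifted in two stages.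

The signs form a finite group. By induction on its order, a path lifts over the times at which its
stabilizers are proper; at the remaining times the fiber is a single point, so that the lift extends
continuously, whatever the choices made elsewhere.

For `SU(2)`, a nonscalar Hermitian part of a matrix of the tuple can be made diagonal, continuously
in time, which reduces the group to the diagonal torus; an off-diagonal entry that does not vanish
can then be made positive, which reduces it to the center. Again the fiber is a single point at the
times at which this is impossible.

The limit at infinity is treated as one more point of the path, after the reparametrization
`t ↦ (1 + t)⁻¹`.
-/

namespace NeckPinching

noncomputable section

/-! ### Lifting paths -/

section Selections

variable {X : Type*} [TopologicalSpace X] {A : ℝ → Set X} {L L' : ℝ → X} {J J' : Set ℝ}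

/-- `L` is a continuous selection over `J` of the family of sets `A`. -/
def IsSelectionOn (A : ℝ → Set X) (L : ℝ → X) (J : Set ℝ) : Prop :=
  ContinuousOn L J ∧ ∀ t ∈ J, L t ∈ A t

/-- Any two points of a member of `A` are exchanged by a continuous map that preserves all members
of `A`. This is what makes it possible to glue selections. -/
def IsHomogeneousFamily (A : ℝ → Set X) : Prop :=
  ∀ t, ∀ x ∈ A t, ∀ x' ∈ A t, ∃ g : X → X, Continuous g ∧ (∀ s, Set.MapsTo g (A s) (A s)) ∧ g x = x'

theorem IsSelectionOn.mono (h : IsSelectionOn A L J) (hJ : J' ⊆ J) : IsSelectionOn A L J' :=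
  ⟨h.1.mono hJ, fun t ht => h.2 t (hJ ht)⟩

theorem IsSelectionOn.congr (h : IsSelectionOn A L J) (hJ : Set.EqOn L' L J) :
    IsSelectionOn A L' J :=
  ⟨h.1.congr hJ, fun t ht => by rw [hJ ht]; exact h.2 t ht⟩

theorem IsSelectionOn.union (h : IsSelectionOn A L J) (h' : IsSelectionOn A L J')
    (hJ : IsClosed J) (hJ' : IsClosed J') : IsSelectionOn A L (J ∪ J') :=
  ⟨h.1.union_of_isClosed h'.1 hJ hJ', fun t ht => ht.elim (h.2 t) (h'.2 t)⟩

theorem IsSelectionOn.exists_extend (hA : IsHomogeneousFamily A) (h : IsSelectionOn A L J)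
    (h' : IsSelectionOn A L' J') (hJ : IsClosed J) (hJ' : IsClosed J') {b : ℝ} (hb : J ∩ J' = {b}) :
    ∃ M, IsSelectionOn A M (J ∪ J') ∧ Set.EqOn M L J := by
  classical
  obtain ⟨hbJ, hbJ'⟩ : b ∈ J ∩ J' := hb.ge rfl
  obtain ⟨g, hg, hgA, hgb⟩ := hA b (L' b) (h'.2 b hbJ') (L b) (h.2 b hbJ)
  have h'' : IsSelectionOn A (g ∘ L') J' :=
    ⟨hg.comp_continuousOn h'.1, fun t ht => hgA t (h'.2 t ht)⟩
  have hL : Set.EqOn (J.piecewise L (g ∘ L')) L J := J.piecewise_eqOn L (g ∘ L')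
  refine ⟨J.piecewise L (g ∘ L'), (h.congr hL).union (h''.congr fun t ht => ?_) hJ hJ', hL⟩
  by_cases htJ : t ∈ J
  · obtain rfl : t = b := hb.le ⟨htJ, ht⟩
    simp [htJ, hgb]
  · simp [htJ]

theorem exists_isSelectionOn_Icc (hA : IsHomogeneousFamily A) {a b : ℝ} (hab : a ≤ b)
    (hloc : ∀ t ∈ Set.Icc a b, ∃ U ∈ 𝓝 t, ∃ L, IsSelectionOn A L U) :
    ∃ L, IsSelectionOn A L (Set.Icc a b) := by
  choose! U hU Λ hΛ using hloc
  obtain ⟨τ, hτ0, hτm, ⟨N, hN⟩, hτ⟩ := exists_monotone_Icc_subset_open_cover_Icc hab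
    (c := fun t : Set.Icc a b => Subtype.val ⁻¹' interior (U t))
    (fun t => isOpen_interior.preimage continuous_subtype_val)
    (fun t _ => Set.mem_iUnion.2 ⟨t, mem_interior_iff_mem_nhds.2 (hU t t.2)⟩)
  have hτn (n : ℕ) : ∃ L, IsSelectionOn A L (Set.Icc a (τ n)) := by
    induction n with
    | zero =>
      have ha : a ∈ Set.Icc a b := ⟨le_rfl, hab⟩
      refine ⟨Λ a ha, (hΛ a ha).mono ?_⟩
      rw [hτ0, Set.Icc_self, Set.singleton_subset_iff]
      exact mem_of_mem_nhds (hU a ha)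
    | succ n ih =>
      obtain ⟨L, hL⟩ := ih
      obtain ⟨t, ht⟩ := hτ n
      have hle : (τ n : ℝ) ≤ τ (n + 1) := hτm n.le_succ
      have hsub : Set.Icc (τ n : ℝ) (τ (n + 1)) ⊆ U t := fun s hs => interior_subset
        (ht (a := ⟨s, (τ n).2.1.trans hs.1, hs.2.trans (τ (n + 1)).2.2⟩) ⟨hs.1, hs.2⟩)
      obtain ⟨M, hM, -⟩ := hL.exists_extend hA ((hΛ t t.2).mono hsub) isClosed_Icc isClosed_Icc
        (Set.Icc_inter_Icc_eq_singleton (τ n).2.1 hle)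
      exact ⟨M, by rwa [Set.Icc_union_Icc_eq_Icc (τ n).2.1 hle] at hM⟩
  simpa only [hN N le_rfl] using hτn N

theorem IsSelectionOn.exists_extend_Icc (hA : IsHomogeneousFamily A) {a b a' b' : ℝ}
    (ha : a' ≤ a) (hab : a ≤ b) (hb : b ≤ b') (h : IsSelectionOn A L (Set.Icc a b))
    (hloc : ∀ t ∈ Set.Icc a' b', ∃ U ∈ 𝓝 t, ∃ L, IsSelectionOn A L U) :
    ∃ M, IsSelectionOn A M (Set.Icc a' b') ∧ Set.EqOn M L (Set.Icc a b) := by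
  obtain ⟨R, hR⟩ := exists_isSelectionOn_Icc hA hb fun t ht =>
    hloc t ⟨(ha.trans hab).trans ht.1, ht.2⟩
  obtain ⟨R', hR'⟩ := exists_isSelectionOn_Icc hA ha fun t ht =>
    hloc t ⟨ht.1, ht.2.trans (hab.trans hb)⟩
  obtain ⟨M, hM, hML⟩ := h.exists_extend hA hR isClosed_Icc isClosed_Icc
    (Set.Icc_inter_Icc_eq_singleton hab hb)
  rw [Set.Icc_union_Icc_eq_Icc hab hb] at hM
  obtain ⟨M', hM', hM'M⟩ := hM.exists_extend hA hR' isClosed_Icc isClosed_Icc (b := a)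
    (by rw [Set.inter_comm, Set.Icc_inter_Icc_eq_singleton ha (hab.trans hb)])
  rw [Set.union_comm, Set.Icc_union_Icc_eq_Icc ha (hab.trans hb)] at hM'
  exact ⟨M', hM', (hM'M.mono (Set.Icc_subset_Icc_right hb)).trans hML⟩

theorem exists_isSelectionOn_iUnion {J : ℕ → Set ℝ} (hJ : Monotone J)
    (hnhds : ∀ t ∈ ⋃ n, J n, ∃ n, J n ∈ 𝓝 t) (h₀ : ∃ L, IsSelectionOn A L (J 0))
    (hextend : ∀ n L, IsSelectionOn A L (J n) →
      ∃ M, IsSelectionOn A M (J (n + 1)) ∧ Set.EqOn M L (J n)) :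
    ∃ L, IsSelectionOn A L (⋃ n, J n) := by
  obtain ⟨L₀, hL₀⟩ := h₀
  choose! next hnext hnextEq using hextend
  let Λ : ℕ → ℝ → X := fun n => Nat.rec L₀ next n
  have hΛ (n : ℕ) : IsSelectionOn A (Λ n) (J n) := by
    induction n with
    | zero => exact hL₀
    | succ n ih => exact hnext n (Λ n) ih
  have hΛEq {m n : ℕ} (hmn : m ≤ n) : Set.EqOn (Λ n) (Λ m) (J m) := by
    induction n, hmn using Nat.le_induction with
    | base => exact fun _ _ => rfl
    | succ n hmn ih => exact ((hnextEq n (Λ n) (hΛ n)).mono (hJ hmn)).trans ih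
  choose! N hN using hnhds
  have hlim (n : ℕ) : Set.EqOn (fun t => Λ (N t) t) (Λ n) (J n) := fun t ht => by
    rcases le_total n (N t) with h | h
    · exact hΛEq h ht
    · exact (hΛEq h (mem_of_mem_nhds (hN t (Set.mem_iUnion_of_mem n ht)))).symm
  refine ⟨fun t => Λ (N t) t, fun t ht => ?_,
    fun t ht => (hΛ (N t)).2 t (mem_of_mem_nhds (hN t ht))⟩
  exact (((hΛ (N t)).congr (hlim (N t))).1.continuousAt (hN t ht)).continuousWithinAt

theorem exists_monotone_Icc_exhaustion (hJ : IsOpen J) (hJc : J.OrdConnected) (hJn : J.Nonempty) :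
    ∃ a b : ℕ → ℝ, Antitone a ∧ Monotone b ∧ (∀ n, a n ≤ b n) ∧ (⋃ n, Set.Icc (a n) (b n) = J) ∧
      ∀ t ∈ J, ∃ n, Set.Icc (a n) (b n) ∈ 𝓝 t := by
  have : Nonempty J := hJn.to_subtype
  let t₀ : J := Classical.arbitrary J
  obtain ⟨a, ha, ha'⟩ := exists_seq_antitone_tendsto_atTop_atBot J
  obtain ⟨b, hb, hb'⟩ := exists_seq_monotone_tendsto_atTop_atTop J
  have hnhds : ∀ t ∈ J, ∃ n, Set.Icc ((a n ⊓ t₀ : J) : ℝ) (b n ⊔ t₀ : J) ∈ 𝓝 t := by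
    intro t ht
    obtain ⟨u, v, htuv, huv, huvJ⟩ := exists_Icc_mem_subset_of_mem_nhds (hJ.mem_nhds ht)
    have huv' : u ≤ v := htuv.1.trans htuv.2
    obtain ⟨n, hna, hnb⟩ :=
      ((ha'.eventually_le_atBot ⟨u, huvJ (Set.left_mem_Icc.2 huv')⟩).and
        (hb'.eventually_ge_atTop ⟨v, huvJ (Set.right_mem_Icc.2 huv')⟩)).exists
    exact ⟨n, mem_of_superset huv
      (Set.Icc_subset_Icc (inf_le_of_left_le hna) (le_sup_of_le_left hnb))⟩
  refine ⟨fun n => (a n ⊓ t₀ : J), fun n => (b n ⊔ t₀ : J), fun m n h => inf_le_inf_right t₀ (ha h),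
    fun m n h => sup_le_sup_right (hb h) t₀, fun n => inf_le_right.trans le_sup_right, ?_, hnhds⟩
  refine (Set.iUnion_subset fun n => hJc.out (Subtype.coe_prop _) (Subtype.coe_prop _)).antisymm
    fun t ht => ?_
  obtain ⟨n, hn⟩ := hnhds t ht
  exact Set.mem_iUnion_of_mem n (mem_of_mem_nhds hn)

theorem exists_isSelectionOn_of_ordConnected (hA : IsHomogeneousFamily A) (hJ : IsOpen J)
    (hJc : J.OrdConnected) (hJn : J.Nonempty)
    (hloc : ∀ t ∈ J, ∃ U ∈ 𝓝 t, ∃ L, IsSelectionOn A L U) : ∃ L, IsSelectionOn A L J := by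
  obtain ⟨a, b, ha, hb, hab, rfl, hnhds⟩ := exists_monotone_Icc_exhaustion hJ hJc hJn
  have hlocn (n : ℕ) : ∀ t ∈ Set.Icc (a n) (b n), ∃ U ∈ 𝓝 t, ∃ L, IsSelectionOn A L U :=
    fun t ht => hloc t (Set.mem_iUnion_of_mem n ht)
  exact exists_isSelectionOn_iUnion (fun m n hmn => Set.Icc_subset_Icc (ha hmn) (hb hmn)) hnhds
    (exists_isSelectionOn_Icc hA (hab 0) (hlocn 0)) fun n L hL =>
      hL.exists_extend_Icc hA (ha n.le_succ) (hab n) (hb n.le_succ) (hlocn (n + 1))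

theorem exists_isSelectionOn_of_isOpen [Nonempty X] (hA : IsHomogeneousFamily A) {O : Set ℝ}
    (hO : IsOpen O) (hloc : ∀ t ∈ O, ∃ U ∈ 𝓝 t, ∃ L, IsSelectionOn A L U) :
    ∃ L, IsSelectionOn A L O := by
  have hnhds {t : ℝ} (ht : t ∈ O) : O.ordConnectedComponent t ∈ 𝓝 t :=
    Set.ordConnectedComponent_mem_nhds.2 (hO.mem_nhds ht)
  have heq {s t : ℝ} (hs : s ∈ O.ordConnectedComponent t) :
      O.ordConnectedComponent s = O.ordConnectedComponent t :=
    (Set.ordConnectedComponent_eq (Set.mem_ordConnectedComponent.1 hs)).symm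
  have hcomp : ∀ K, (∃ t ∈ O, O.ordConnectedComponent t = K) → ∃ L, IsSelectionOn A L K := by
    rintro _ ⟨t, ht, rfl⟩
    refine exists_isSelectionOn_of_ordConnected hA (isOpen_iff_mem_nhds.2 fun s hs => ?_)
      inferInstance ⟨t, mem_of_mem_nhds (hnhds ht)⟩
      fun s hs => hloc s (Set.ordConnectedComponent_subset hs)
    rw [← heq hs]
    exact hnhds (Set.ordConnectedComponent_subset hs)
  choose! Λ hΛ using hcomp
  refine ⟨fun t => Λ (O.ordConnectedComponent t) t, fun t ht => ?_, fun t ht =>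
    (hΛ _ ⟨t, ht, rfl⟩).2 t (mem_of_mem_nhds (hnhds ht))⟩
  refine (((hΛ _ ⟨t, ht, rfl⟩).1.continuousAt (hnhds ht)).congr ?_).continuousWithinAt
  filter_upwards [hnhds ht] with s hs
  rw [heq hs]

theorem exists_continuous_selection (hA : IsHomogeneousFamily A) (hne : ∀ t, (A t).Nonempty)
    (hloc : ∀ t, (∃ U ∈ 𝓝 t, ∃ L, IsSelectionOn A L U) ∨
      (A t).Subsingleton ∧ UpperHemicontinuousAt A t) :
    ∃ L : ℝ → X, Continuous L ∧ ∀ t, L t ∈ A t := by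
  classical
  have : Nonempty X := (hne 0).nonempty
  let O : Set ℝ := {t | ∃ U ∈ 𝓝 t, ∃ L, IsSelectionOn A L U}
  have hO : IsOpen O := isOpen_iff_eventually.2 fun t ⟨U, hU, L, hL⟩ =>
    (eventually_eventually_nhds.2 hU).mono fun s hs => ⟨U, hs, L, hL⟩
  obtain ⟨L, hL⟩ := exists_isSelectionOn_of_isOpen hA hO fun t ht => ht
  choose c hc using hne
  have hmem (t : ℝ) : O.piecewise L c t ∈ A t := by
    by_cases ht : t ∈ O
    · simpa only [Set.piecewise_eq_of_mem _ _ _ ht] using hL.2 t ht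
    · simpa only [Set.piecewise_eq_of_notMem _ _ _ ht] using hc t
  refine ⟨O.piecewise L c, continuous_iff_continuousAt.2 fun t => ?_, hmem⟩
  by_cases ht : t ∈ O
  · exact (hL.1.continuousAt (hO.mem_nhds ht)).congr
      ((Set.piecewise_eqOn O L c).symm.eventuallyEq_of_mem (hO.mem_nhds ht))
  · -- At a point of `Oᶜ` every selection, continuous or not, is continuous.
    obtain ⟨hsub, hhemi⟩ := (hloc t).resolve_left ht
    rw [upperHemicontinuousAt_iff_forall_isOpen] at hhemi
    intro W hW
    obtain ⟨W', hW'W, hW', htW'⟩ := mem_nhds_iff.1 hW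
    have hAt : A t ⊆ W' := fun x hx => hsub (hmem t) hx ▸ htW'
    exact (hhemi W' hW' hAt).mono fun s hs => hW'W (hs (hmem s))

end Selections

section LiftsPaths

variable {X Y : Type*} [TopologicalSpace X] {q : X → Y} {S S' : Set X} {V V' : Set Y}

/-- Any two points of `S` in the same fiber of `q`, over a point of `V`, are exchanged by a
continuous map that preserves the fibers of `q` in `S`, over `V`. -/
def TransitiveOnFibers (q : X → Y) (S : Set X) (V : Set Y) : Prop :=
  ∀ y ∈ V, ∀ x ∈ q ⁻¹' {y} ∩ S, ∀ x' ∈ q ⁻¹' {y} ∩ S, ∃ g : X → X, Continuous g ∧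
    (∀ z ∈ V, Set.MapsTo g (q ⁻¹' {z} ∩ S) (q ⁻¹' {z} ∩ S)) ∧ g x = x'

variable [TopologicalSpace Y]

/-- Every path in `V`, parametrized by the real line, lifts along `q` to a path in `S`. -/
def LiftsPaths (q : X → Y) (S : Set X) (V : Set Y) : Prop :=
  ∀ f : ℝ → Y, Continuous f → (∀ t, f t ∈ V) →
    ∃ L : ℝ → X, Continuous L ∧ ∀ t, L t ∈ q ⁻¹' {f t} ∩ S

theorem LiftsPaths.mono (h : LiftsPaths q S V) (hS : S ⊆ S') (hV : V' ⊆ V) :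
    LiftsPaths q S' V' := fun f hf hfV => by
  obtain ⟨L, hL, hLf⟩ := h f hf fun t => hV (hfV t)
  exact ⟨L, hL, fun t => ⟨(hLf t).1, hS (hLf t).2⟩⟩

theorem LiftsPaths.exists_isSelectionOn_nhds (h : LiftsPaths q S V) {f : ℝ → Y} (hf : Continuous f)
    {t : ℝ} (ht : V ∈ 𝓝 (f t)) :
    ∃ U ∈ 𝓝 t, ∃ L, IsSelectionOn (fun t => q ⁻¹' {f t} ∩ S) L U := by
  obtain ⟨a, b, htab, hab, habV⟩ :=
    exists_Icc_mem_subset_of_mem_nhds (hf.continuousAt.preimage_mem_nhds ht)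
  have hle : a ≤ b := htab.1.trans htab.2
  obtain ⟨L, hL, hLf⟩ := h (fun s => f (Set.projIcc a b hle s)) (by fun_prop)
    fun s => habV (Set.projIcc a b hle s).2
  refine ⟨Set.Icc a b, hab, L, hL.continuousOn, fun s hs => ?_⟩
  simpa only [Set.projIcc_of_mem hle hs] using hLf s

theorem LiftsPaths.of_local (htr : TransitiveOnFibers q S V)
    (hne : ∀ y ∈ V, (q ⁻¹' {y} ∩ S).Nonempty)
    (hloc : ∀ y ∈ V, (∃ V' ∈ 𝓝 y, LiftsPaths q S V') ∨
      (q ⁻¹' {y} ∩ S).Subsingleton ∧ UpperHemicontinuousAt (fun y => q ⁻¹' {y} ∩ S) y) :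
    LiftsPaths q S V := by
  intro f hf hfV
  refine exists_continuous_selection (fun t x hx x' hx' => ?_) (fun t => hne _ (hfV t)) fun t => ?_
  · obtain ⟨g, hg, hgV, hgx⟩ := htr _ (hfV t) x hx x' hx'
    exact ⟨g, hg, fun s => hgV _ (hfV s), hgx⟩
  · obtain ⟨V', hV', h⟩ | ⟨hsub, hhemi⟩ := hloc _ (hfV t)
    · exact Or.inl (h.exists_isSelectionOn_nhds hf hV')
    · exact Or.inr ⟨hsub, hhemi.comp hf.continuousAt⟩

end LiftsPaths

section FiniteQuotients

variable {X Y D : Type*} [TopologicalSpace X] [TopologicalSpace Y] [Group D] [MulAction D X]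
  {q : X → Y} {S : Set X} {V : Set Y}

variable (D) in
/-- Over `V`, the fibers of `q` in `S` are orbits of the group `D`, and they vary upper
hemicontinuously. -/
structure IsOrbitMapOn (q : X → Y) (S : Set X) (V : Set Y) : Prop where
  nonempty : ∀ y ∈ V, (q ⁻¹' {y} ∩ S).Nonempty
  mapsTo_smul : ∀ (g : D), ∀ y ∈ V, Set.MapsTo (g • ·) (q ⁻¹' {y} ∩ S) (q ⁻¹' {y} ∩ S)
  exists_smul_eq : ∀ y ∈ V, ∀ x ∈ q ⁻¹' {y} ∩ S, ∀ x' ∈ q ⁻¹' {y} ∩ S, ∃ g : D, g • x = x'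
  upperHemicontinuousAt : ∀ y ∈ V, UpperHemicontinuousAt (fun y => q ⁻¹' {y} ∩ S) y

theorem IsOrbitMapOn.mono {V' : Set Y} (h : IsOrbitMapOn D q S V) (hV : V' ⊆ V) :
    IsOrbitMapOn D q S V' where
  nonempty y hy := h.nonempty y (hV hy)
  mapsTo_smul g y hy := h.mapsTo_smul g y (hV hy)
  exists_smul_eq y hy := h.exists_smul_eq y (hV hy)
  upperHemicontinuousAt y hy := h.upperHemicontinuousAt y (hV hy)

theorem IsOrbitMapOn.transitiveOnFibers [ContinuousConstSMul D X] (h : IsOrbitMapOn D q S V) :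
    TransitiveOnFibers q S V := fun y hy x hx x' hx' => by
  obtain ⟨g, hg⟩ := h.exists_smul_eq y hy x hx x' hx'
  exact ⟨(g • ·), continuous_const_smul g, h.mapsTo_smul g, hg⟩

theorem exists_isOpen_stabilizer_invariant [ContinuousConstSMul D X] [Finite D] [T2Space X]
    (x : X) : ∃ U, IsOpen U ∧ x ∈ U ∧
      (∀ g ∈ MulAction.stabilizer D x, Set.MapsTo (g • ·) U U) ∧
      ∀ g : D, ∀ z ∈ U, g • z ∈ U → g ∈ MulAction.stabilizer D x := by
  obtain ⟨W, hW, hdisj⟩ := (Set.finite_range fun g : D => g • x).t2_separation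
  have hmem {z : X} (hz : z ∈ ⋂ g : D, (g • ·) ⁻¹' W (g • x)) (g : D) : g • z ∈ W (g • x) :=
    Set.mem_iInter.1 hz g
  refine ⟨⋂ g : D, (g • ·) ⁻¹' W (g • x), isOpen_iInter_of_finite fun g =>
    (hW _).2.preimage (continuous_const_smul g), Set.mem_iInter.2 fun g => (hW _).1, ?_, ?_⟩
  · intro k hk z hz
    refine Set.mem_iInter.2 fun g => ?_
    simpa only [Set.mem_preimage, mul_smul, MulAction.mem_stabilizer_iff.1 hk]
      using hmem hz (g * k)
  · intro g z hz hgz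
    by_contra hne
    refine (hdisj (Set.mem_range_self g) ⟨1, one_smul D x⟩ hne).le_bot ⟨hmem hz g, ?_⟩
    simpa only [one_smul] using hmem hgz 1

theorem IsOrbitMapOn.restrict_stabilizer [ContinuousConstSMul D X] (h : IsOrbitMapOn D q S V)
    {x : X} {U : Set X} (hU : IsOpen U)
    (hinv : ∀ g ∈ MulAction.stabilizer D x, Set.MapsTo (g • ·) U U)
    (hstab : ∀ g : D, ∀ z ∈ U, g • z ∈ U → g ∈ MulAction.stabilizer D x) :
    IsOrbitMapOn (MulAction.stabilizer D x) q (S ∩ U)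
      {y ∈ V | q ⁻¹' {y} ∩ S ⊆ ⋃ g : D, (g • ·) ⁻¹' U} where
  nonempty := by
    rintro y ⟨hyV, hy⟩
    obtain ⟨z, hz⟩ := h.nonempty y hyV
    obtain ⟨g, hg⟩ := Set.mem_iUnion.1 (hy hz)
    obtain ⟨hgq, hgS⟩ := h.mapsTo_smul g y hyV hz
    exact ⟨g • z, hgq, hgS, hg⟩
  mapsTo_smul := by
    rintro g y ⟨hyV, -⟩ z ⟨hzq, hzS, hzU⟩
    obtain ⟨hgq, hgS⟩ := h.mapsTo_smul g y hyV ⟨hzq, hzS⟩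
    exact ⟨hgq, hgS, hinv g g.2 hzU⟩
  exists_smul_eq := by
    rintro y ⟨hyV, -⟩ z ⟨hzq, hzS, hzU⟩ z' ⟨hzq', hzS', hzU'⟩
    obtain ⟨g, rfl⟩ := h.exists_smul_eq y hyV z ⟨hzq, hzS⟩ z' ⟨hzq', hzS'⟩
    exact ⟨⟨g, hstab g z hzU hzU'⟩, rfl⟩
  upperHemicontinuousAt := by
    rintro y ⟨hyV, hy⟩
    have hhemi := h.upperHemicontinuousAt y hyV
    rw [upperHemicontinuousAt_iff_forall_isOpen] at hhemi ⊢
    intro W hW hyW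
    -- The translates of `U` other than `U` itself are disjoint from `U`.
    let U' : Set X := ⋃ g : {g : D // g ∉ MulAction.stabilizer D x}, (g.1 • ·) ⁻¹' U
    have hU' : IsOpen U' :=
      isOpen_iUnion fun g => hU.preimage (continuous_const_smul g.1)
    refine (hhemi (W ∪ U') (hW.union hU') fun z hz => ?_).mono fun y' hy' z hz => ?_
    · obtain ⟨g, hg⟩ := Set.mem_iUnion.1 (hy hz)
      by_cases hgx : g ∈ MulAction.stabilizer D x
      · refine Or.inl (hyW ⟨hz.1, hz.2, ?_⟩)
        simpa only [inv_smul_smul] using hinv g⁻¹ (inv_mem hgx) hg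
      · exact Or.inr (Set.mem_iUnion.2 ⟨⟨g, hgx⟩, hg⟩)
    · refine (hy' ⟨hz.1, hz.2.1⟩).resolve_right fun hzU' => ?_
      obtain ⟨g, hg⟩ := Set.mem_iUnion.1 hzU'
      exact g.2 (hstab g z hz.2.2 hg)

theorem IsOrbitMapOn.liftsPaths [ContinuousConstSMul D X] [Finite D] [T2Space X]
    (h : IsOrbitMapOn D q S V) (hV : IsOpen V) : LiftsPaths q S V := by
  induction hn : Nat.card D using Nat.strong_induction_on generalizing D S V with
  | _ n ih =>
  subst hn
  refine .of_local h.transitiveOnFibers h.nonempty fun y hy => ?_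
  obtain ⟨x, hx⟩ := h.nonempty y hy
  by_cases hfix : MulAction.stabilizer D x = ⊤
  · refine Or.inr ⟨Set.subsingleton_of_subset_singleton (a := x) fun z hz => ?_,
      h.upperHemicontinuousAt y hy⟩
    obtain ⟨g, rfl⟩ := h.exists_smul_eq y hy x hx z hz
    exact MulAction.mem_stabilizer_iff.1 (hfix ▸ Subgroup.mem_top g)
  · left
    obtain ⟨U, hU, hxU, hinv, hstab⟩ := exists_isOpen_stabilizer_invariant (D := D) x
    have hopen : IsOpen (⋃ g : D, (g • ·) ⁻¹' U) :=
      isOpen_iUnion fun g => hU.preimage (continuous_const_smul g)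
    have hsub : q ⁻¹' {y} ∩ S ⊆ ⋃ g : D, (g • ·) ⁻¹' U := fun z hz => by
      obtain ⟨g, hg⟩ := h.exists_smul_eq y hy z hz x hx
      exact Set.mem_iUnion.2 ⟨g, by rwa [Set.mem_preimage, hg]⟩
    obtain ⟨V', hV', hV'o, hyV'⟩ := mem_nhds_iff.1 ((hV.eventually_mem hy).and
      (upperHemicontinuousAt_iff_forall_isOpen.1 (h.upperHemicontinuousAt y hy) _ hopen hsub))
    have hlt : Nat.card (MulAction.stabilizer D x) < Nat.card D :=
      (Subgroup.card_le_card_group _).lt_of_ne (mt (Subgroup.card_eq_iff_eq_top _).1 hfix)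
    have : ContinuousConstSMul (MulAction.stabilizer D x) X :=
      ⟨fun g => continuous_const_smul (g : D)⟩
    exact ⟨V', hV'o.mem_nhds hyV', LiftsPaths.mono
      (ih _ hlt ((h.restrict_stabilizer hU hinv hstab).mono hV') hV'o rfl)
      Set.inter_subset_left subset_rfl⟩

end FiniteQuotients

/-! ### The special unitary group -/

section SpecialUnitary

open Matrix ComplexConjugate

variable {n : Type*} [Fintype n] [DecidableEq n]

theorem coe_inv_of_mem_unitaryGroup {g : Matrix.SpecialLinearGroup n ℂ}
    (hg : (g : Matrix n n ℂ) ∈ unitaryGroup n ℂ) :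
    ((g⁻¹ : Matrix.SpecialLinearGroup n ℂ) : Matrix n n ℂ) = (g : Matrix n n ℂ)ᴴ := by
  refine (left_inv_eq_right_inv (mem_unitaryGroup_iff'.1 hg) ?_).symm
  rw [← Matrix.SpecialLinearGroup.coe_mul, mul_inv_cancel, Matrix.SpecialLinearGroup.coe_one]

/-- The special unitary group as a subgroup of `SL(n, ℂ)`, from which it takes its topology and its
actions. -/
def specialUnitary (n : Type*) [Fintype n] [DecidableEq n] :
    Subgroup (Matrix.SpecialLinearGroup n ℂ) where
  carrier := {g | (g : Matrix n n ℂ) ∈ unitaryGroup n ℂ}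
  mul_mem' {a b} ha hb := by
    simpa only [Set.mem_ofPred_eq, Matrix.SpecialLinearGroup.coe_mul] using mul_mem ha hb
  one_mem' := by
    simp only [Set.mem_ofPred_eq, Matrix.SpecialLinearGroup.coe_one, one_mem]
  inv_mem' {g} hg := by
    rw [Set.mem_ofPred_eq, coe_inv_of_mem_unitaryGroup hg]
    exact Unitary.star_mem hg

theorem mem_specialUnitary_iff {g : Matrix.SpecialLinearGroup n ℂ} :
    g ∈ specialUnitary n ↔ (g : Matrix n n ℂ)ᴴ * g = 1 :=
  mem_unitaryGroup_iff'

theorem conjTranspose_mul_self (k : specialUnitary n) : (k : Matrix n n ℂ)ᴴ * k = 1 :=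
  mem_specialUnitary_iff.1 k.2

theorem mul_conjTranspose_self (k : specialUnitary n) :
    (k : Matrix n n ℂ) * (k : Matrix n n ℂ)ᴴ = 1 :=
  mem_unitaryGroup_iff.1 k.2

theorem isCompact_specialUnitary :
    IsCompact (specialUnitary n : Set (Matrix.SpecialLinearGroup n ℂ)) := by
  have hpi : IsCompact (Set.univ.pi fun _ => Set.univ.pi fun _ => Metric.closedBall 0 1 :
      Set (Matrix n n ℂ)) :=
    isCompact_univ_pi fun _ : n => isCompact_univ_pi fun _ : n => isCompact_closedBall (0 : ℂ) 1
  refine (Matrix.SpecialLinearGroup.isClosedEmbedding_val.isCompact_preimage hpi).of_isClosed_subset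
    (isClosed_unitary.preimage continuous_subtype_val) fun g hg i _ j _ => ?_
  exact mem_closedBall_zero_iff.2 (entry_norm_bound_of_unitary hg i j)

instance : CompactSpace (specialUnitary n) :=
  isCompact_iff_compactSpace.1 isCompact_specialUnitary

theorem conj_mul_self_of_norm_eq_one {c : ℂ} (hc : ‖c‖ = 1) : conj c * c = 1 := by
  rw [← Complex.normSq_eq_conj_mul_self, Complex.normSq_eq_norm_sq, hc]
  simp

theorem center_le_specialUnitary [Nonempty n] :
    Subgroup.center (Matrix.SpecialLinearGroup n ℂ) ≤ specialUnitary n := by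
  intro z hz
  obtain ⟨r, hr, hzr⟩ := Matrix.SpecialLinearGroup.mem_center_iff.1 hz
  have hnorm : ‖r‖ = 1 := Complex.norm_eq_one_of_pow_eq_one hr Fintype.card_ne_zero
  rw [mem_specialUnitary_iff, ← hzr, scalar_apply, diagonal_conjTranspose, diagonal_mul_diagonal]
  simp [conj_mul_self_of_norm_eq_one hnorm]

theorem exists_specialUnitary_conj_eq [Nonempty n] {U : Matrix n n ℂ} (hU : U ∈ unitaryGroup n ℂ) :
    ∃ k : specialUnitary n, ∀ M : Matrix n n ℂ, k * M * (k : Matrix n n ℂ)ᴴ = U * M * Uᴴ := by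
  have hdet : ‖U.det‖ = 1 := CStarRing.norm_of_mem_unitary (det_of_mem_unitary hU)
  obtain ⟨c, hc⟩ := IsAlgClosed.exists_pow_nat_eq (conj U.det) (Fintype.card_pos (α := n))
  have hcU : conj c * c = 1 := by
    refine conj_mul_self_of_norm_eq_one ((pow_eq_one_iff_of_nonneg (norm_nonneg c)
      (Fintype.card_ne_zero (α := n))).1 ?_)
    rw [← norm_pow, hc, RCLike.norm_conj, hdet]
  have hmem : c • U ∈ unitaryGroup n ℂ := by
    rw [mem_unitaryGroup_iff', star_smul, smul_mul_smul, mem_unitaryGroup_iff'.1 hU]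
    simp [hcU]
  refine ⟨⟨⟨c • U, ?_⟩, hmem⟩, fun M => ?_⟩
  · rw [det_smul, hc, conj_mul_self_of_norm_eq_one hdet]
  · change c • U * M * (c • U)ᴴ = U * M * Uᴴ
    rw [conjTranspose_smul, Matrix.smul_mul, Matrix.smul_mul, Matrix.mul_smul, smul_smul,
      RCLike.star_def, mul_comm c, hcU, one_smul]

theorem exists_specialUnitary_conj_eq_diagonal [Nonempty n] {H : Matrix n n ℂ}
    (hH : H.IsHermitian) :
    ∃ (k : specialUnitary n) (d : n → ℝ),
      k * H * (k : Matrix n n ℂ)ᴴ = diagonal fun i => (d i : ℂ) := by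
  obtain ⟨k, hk⟩ := exists_specialUnitary_conj_eq (Unitary.star_mem hH.eigenvectorUnitary.2)
  refine ⟨k, hH.eigenvalues, (hk H).trans ?_⟩
  exact hH.conjStarAlgAut_star_eigenvectorUnitary

end SpecialUnitary

/-! ### The Frobenius norm -/

section Frobenius

open Matrix

variable {m n : Type*} [Fintype m] [Fintype n]

/-- The squared Frobenius norm of a complex matrix. -/
def frobeniusSq (M : Matrix m n ℂ) : ℝ :=
  ∑ i, ∑ j, ‖M i j‖ ^ 2

theorem frobeniusSq_nonneg (M : Matrix m n ℂ) : 0 ≤ frobeniusSq M := by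
  unfold frobeniusSq
  positivity

theorem norm_sq_le_frobeniusSq (M : Matrix m n ℂ) (i : m) (j : n) :
    ‖M i j‖ ^ 2 ≤ frobeniusSq M :=
  (Finset.single_le_sum (f := fun j => ‖M i j‖ ^ 2) (fun _ _ => sq_nonneg _)
    (Finset.mem_univ j)).trans
  (Finset.single_le_sum (f := fun i => ∑ j, ‖M i j‖ ^ 2)
    (fun _ _ => Finset.sum_nonneg fun _ _ => sq_nonneg _) (Finset.mem_univ i))

theorem continuous_frobeniusSq : Continuous (frobeniusSq (m := m) (n := n)) :=
  continuous_finsetSum _ fun i _ => continuous_finsetSum _ fun j _ =>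
    (continuous_apply_apply i j).norm.pow 2

theorem isCompact_setOf_frobeniusSq_le (c : ℝ) :
    IsCompact {M : Matrix m n ℂ | frobeniusSq M ≤ c} := by
  have hpi : IsCompact (Set.univ.pi fun _ => Set.univ.pi fun _ => Metric.closedBall 0 (√c) :
      Set (Matrix m n ℂ)) :=
    isCompact_univ_pi fun _ : m => isCompact_univ_pi fun _ : n => isCompact_closedBall (0 : ℂ) _
  refine hpi.of_isClosed_subset (isClosed_le continuous_frobeniusSq continuous_const)
    fun M hM i _ j _ => mem_closedBall_zero_iff.2 (Real.le_sqrt_of_sq_le ?_)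
  exact (norm_sq_le_frobeniusSq M i j).trans hM

theorem ofReal_frobeniusSq (M : Matrix m n ℂ) : (frobeniusSq M : ℂ) = (Mᴴ * M).trace := by
  simp only [frobeniusSq, trace, diag_apply, mul_apply, conjTranspose_apply, RCLike.star_def,
    Complex.conj_mul', Complex.ofReal_sum, Complex.ofReal_pow]
  exact Finset.sum_comm

variable [DecidableEq n]

theorem frobeniusSq_unitary_mul {U : Matrix n n ℂ} (hU : U ∈ unitaryGroup n ℂ)
    (M : Matrix n m ℂ) : frobeniusSq (U * M) = frobeniusSq M := by
  rw [← Complex.ofReal_inj, ofReal_frobeniusSq, ofReal_frobeniusSq, conjTranspose_mul,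
    Matrix.mul_assoc, ← Matrix.mul_assoc Uᴴ, ← star_eq_conjTranspose U,
    mem_unitaryGroup_iff'.1 hU, Matrix.one_mul]

theorem frobeniusSq_mul_unitary {U : Matrix n n ℂ} (hU : U ∈ unitaryGroup n ℂ)
    (M : Matrix m n ℂ) : frobeniusSq (M * U) = frobeniusSq M := by
  rw [← Complex.ofReal_inj, ofReal_frobeniusSq, ofReal_frobeniusSq, conjTranspose_mul,
    ← Matrix.mul_assoc, trace_mul_comm, ← star_eq_conjTranspose U, ← Matrix.mul_assoc,
    ← Matrix.mul_assoc, mem_unitaryGroup_iff.1 hU, Matrix.one_mul]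

end Frobenius

/-! ### Tuples and simultaneous conjugation -/

section Tuples

/-- Families of elements of a group, on which the group acts by simultaneous conjugation; a type
synonym, since the pointwise action on `ι → G` is multiplication. -/
def Tuple (ι G : Type*) : Type _ := ι → G

/-- Families of central elements, which act on tuples by multiplication. -/
abbrev CentralTuple (ι G : Type*) [Group G] : Type _ := ι → Subgroup.center G

variable {ι G : Type*}

instance [TopologicalSpace G] : TopologicalSpace (Tuple ι G) :=
  inferInstanceAs (TopologicalSpace (ι → G))

instance [TopologicalSpace G] [T2Space G] : T2Space (Tuple ι G) :=
  inferInstanceAs (T2Space (ι → G))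

theorem continuous_tuple_apply [TopologicalSpace G] (i : ι) : Continuous fun A : Tuple ι G => A i :=
  continuous_apply i

variable [Group G]

instance : MulAction G (Tuple ι G) where
  smul g A := fun i => g * A i * g⁻¹
  one_smul A := funext fun i => by change 1 * A i * 1⁻¹ = A i; group
  mul_smul g h A := funext fun i => by
    change (g * h) * A i * (g * h)⁻¹ = g * (h * A i * h⁻¹) * g⁻¹
    group

instance : MulAction (CentralTuple ι G) (Tuple ι G) where
  smul z A := fun i => z i * A i
  one_smul A := funext fun i => one_mul (A i)
  mul_smul z w A := funext fun i => mul_assoc (z i : G) (w i) (A i)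

theorem central_smul_apply (z : CentralTuple ι G) (A : Tuple ι G) (i : ι) :
    (z • A) i = z i * A i := rfl

instance : SMulCommClass (CentralTuple ι G) G (Tuple ι G) where
  smul_comm z g A := funext fun i => by
    change (z i : G) * (g * A i * g⁻¹) = g * (z i * A i) * g⁻¹
    rw [← mul_assoc g, Subgroup.mem_center_iff.1 (z i).2 g]
    simp only [mul_assoc]

/-- The orbit of a tuple under simultaneous conjugation and multiplication by central elements. -/
def centralConjOrbit (A : Tuple ι G) : Set (Tuple ι G) :=
  {B | ∃ (z : CentralTuple ι G) (g : G), z • g • A = B}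

theorem self_mem_centralConjOrbit (A : Tuple ι G) : A ∈ centralConjOrbit A :=
  ⟨1, 1, by rw [one_smul, one_smul]⟩

theorem smul_smul_mem_centralConjOrbit {A B : Tuple ι G} (h : B ∈ centralConjOrbit A)
    (z : CentralTuple ι G) (g : G) : z • g • B ∈ centralConjOrbit A := by
  obtain ⟨w, h, rfl⟩ := h
  exact ⟨z * w, g * h, by rw [mul_smul, mul_smul, smul_comm w g]⟩

theorem mem_centralConjOrbit_symm {A B : Tuple ι G} (h : B ∈ centralConjOrbit A) :
    A ∈ centralConjOrbit B := by
  obtain ⟨z, g, rfl⟩ := h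
  exact ⟨z⁻¹, g⁻¹, by rw [← smul_comm z, inv_smul_smul, inv_smul_smul]⟩

variable [TopologicalSpace G] [IsTopologicalGroup G]

instance : ContinuousSMul G (Tuple ι G) where
  continuous_smul := continuous_pi fun i =>
    (continuous_fst.mul ((continuous_tuple_apply i).comp continuous_snd)).mul continuous_fst.inv

instance : ContinuousConstSMul (CentralTuple ι G) (Tuple ι G) where
  continuous_const_smul _ := continuous_pi fun i => continuous_const.mul (continuous_tuple_apply i)

theorem continuous_central_smul_conj_smul (z : CentralTuple ι G) (g : G) :
    Continuous fun A : Tuple ι G => z • g • A :=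
  (continuous_const_smul z).comp (continuous_const_smul g)

theorem smul_smul_mem_closure_centralConjOrbit {A B : Tuple ι G}
    (h : B ∈ closure (centralConjOrbit A)) (z : CentralTuple ι G) (g : G) :
    z • g • B ∈ closure (centralConjOrbit A) :=
  map_mem_closure (f := (z • g • ·)) (continuous_central_smul_conj_smul z g) h fun _ hC =>
    smul_smul_mem_centralConjOrbit hC z g

theorem closure_centralConjOrbit_subset {A B : Tuple ι G} (h : B ∈ closure (centralConjOrbit A)) :
    closure (centralConjOrbit B) ⊆ closure (centralConjOrbit A) := by
  refine closure_minimal ?_ isClosed_closure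
  rintro _ ⟨z, g, rfl⟩
  exact smul_smul_mem_closure_centralConjOrbit h z g

theorem mk_mem_closure_setOf_mem_centralConjOrbit {A B C : Tuple ι G}
    (hA : (A, C) ∈ closure {x : Tuple ι G × Tuple ι G | x.1 ∈ closure (centralConjOrbit x.2)})
    (hB : B ∈ closure (centralConjOrbit C)) :
    (A, B) ∈ closure {x : Tuple ι G × Tuple ι G | x.2 ∈ centralConjOrbit x.1} := by
  set R := {x : Tuple ι G × Tuple ι G | x.2 ∈ centralConjOrbit x.1}
  have hAC : (A, C) ∈ closure R := closure_minimal (t := closure R) (fun x hx =>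
    map_mem_closure (Continuous.prodMk_left x.2) hx fun _ => mem_centralConjOrbit_symm)
    isClosed_closure hA
  refine closure_minimal (t := {D | (A, D) ∈ closure R}) ?_
    (isClosed_closure.preimage (Continuous.prodMk_right A)) hB
  rintro _ ⟨z, g, rfl⟩
  exact map_mem_closure (f := Prod.map id (z • g • ·))
    (continuous_id.prodMap (continuous_central_smul_conj_smul z g)) hAC
    fun _ hx => smul_smul_mem_centralConjOrbit hx z g

end Tuples

/-! ### Orbits of a compact group -/

section CompactOrbits

variable {K X : Type*} [Group K] [MulAction K X]

variable (K) in
/-- The projection to the orbit space, applied to a point. -/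
def toOrbit (x : X) : MulAction.orbitRel.Quotient K X := Quotient.mk'' x

theorem toOrbit_surjective : Function.Surjective (toOrbit K (X := X)) :=
  Quotient.mk''_surjective

theorem toOrbit_eq_iff {x y : X} : toOrbit K x = toOrbit K y ↔ ∃ k : K, k • x = y := by
  rw [eq_comm]
  exact Quotient.eq''

theorem toOrbit_smul (k : K) (x : X) : toOrbit K (k • x) = toOrbit K x :=
  (toOrbit_eq_iff.2 ⟨k, rfl⟩).symm

variable [TopologicalSpace K] [CompactSpace K] [TopologicalSpace X] [ContinuousSMul K X]

theorem t2Space_orbitRel_quotient [T2Space X] : T2Space (MulAction.orbitRel.Quotient K X) := by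
  have : ProperSMul K X := by
    rw [properSMul_iff_continuousSMul_ultrafilter_tendsto_t2]
    refine ⟨inferInstance, fun 𝒰 _ _ _ => ?_⟩
    obtain ⟨g, -, hg⟩ := isCompact_univ.ultrafilter_le_nhds (𝒰.map Prod.fst)
      (le_principal_iff.2 univ_mem)
    exact ⟨g, hg⟩
  exact t2Space_quotient_mulAction_of_properSMul

theorem isClosedMap_toOrbit [ContinuousInv K] : IsClosedMap (toOrbit K (X := X)) :=
  MulAction.isClosedMap_quotient

variable {S : Set X} {V : Set (MulAction.orbitRel.Quotient K X)}

theorem upperHemicontinuous_toOrbit_fiber_inter [ContinuousInv K] (hS : IsClosed S) :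
    UpperHemicontinuous fun y => toOrbit K ⁻¹' {y} ∩ S := fun y =>
  UpperHemicontinuousAt.inter (isClosedMap_iff_upperHemicontinuous.1 isClosedMap_toOrbit y) hS

theorem LiftsPaths.of_slice [ContinuousInv K] (hS : IsClosed S)
    (hmem : ∀ x, toOrbit K x ∈ V → ∃ k : K, k • x ∈ S)
    (htr : ∀ x ∈ S, toOrbit K x ∈ V → ∀ k : K, k • x ∈ S →
      ∃ g : K, Set.MapsTo (g • ·) S S ∧ g • x = k • x)
    (hloc : ∀ x ∈ S, toOrbit K x ∈ V →
      (∃ V' ∈ 𝓝 (toOrbit K x), LiftsPaths (toOrbit K) S V') ∨ ∀ k : K, k • x ∈ S → k • x = x) :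
    LiftsPaths (toOrbit K) S V := by
  have hne : ∀ y ∈ V, (toOrbit K ⁻¹' {y} ∩ S).Nonempty := fun y hy => by
    obtain ⟨x, rfl⟩ := toOrbit_surjective y
    obtain ⟨k, hk⟩ := hmem x hy
    exact ⟨k • x, toOrbit_smul k x, hk⟩
  refine .of_local ?_ hne fun y hy => ?_
  · rintro _ hy x ⟨rfl, hx⟩ x' ⟨hxx', hx'⟩
    obtain ⟨k, rfl⟩ := toOrbit_eq_iff.1 hxx'.symm
    obtain ⟨g, hg, hgx⟩ := htr x hx hy k hx'
    exact ⟨(g • ·), continuous_const_smul g,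
      fun z _ w hw => ⟨(toOrbit_smul g w).trans hw.1, hg hw.2⟩, hgx⟩
  · obtain ⟨x, rfl, hx⟩ := hne y hy
    refine (hloc x hx hy).imp_right fun hfix =>
      ⟨Set.subsingleton_of_subset_singleton (a := x) ?_,
        upperHemicontinuous_toOrbit_fiber_inter hS _⟩
    rintro x' ⟨hxx', hx'⟩
    obtain ⟨k, rfl⟩ := toOrbit_eq_iff.1 hxx'.symm
    exact hfix k hx'

end CompactOrbits

/-! ### The diagonal torus of `SL(2, ℂ)` -/

/-- The algebra of complex `2 × 2` matrices. -/
abbrev Mat2 : Type := Matrix (Fin 2) (Fin 2) ℂ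

/-- The group `SL(2, ℂ)`. -/
abbrev SL2C : Type := Matrix.SpecialLinearGroup (Fin 2) ℂ

/-- The group `SU(2)`, as a subgroup of `SL(2, ℂ)`. -/
abbrev SU2 : Subgroup SL2C := specialUnitary (Fin 2)

section Torus

open Matrix ComplexConjugate

/-- The one-parameter group of diagonal matrices with entries `u` and `u⁻¹`. -/
def torus : ℂˣ →* SL2C where
  toFun u := ⟨diagonal ![(u : ℂ), (u : ℂ)⁻¹], by
    rw [det_diagonal, Fin.prod_univ_two]
    exact mul_inv_cancel₀ u.ne_zero⟩
  map_one' := by ext a b; fin_cases a <;> fin_cases b <;> simp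
  map_mul' u v := Subtype.ext <| by
    refine Eq.trans (congrArg diagonal ?_) (diagonal_mul_diagonal _ _).symm
    ext a
    fin_cases a <;> simp [mul_comm]

theorem coe_torus (u : ℂˣ) : (torus u : Mat2) = diagonal ![(u : ℂ), (u : ℂ)⁻¹] :=
  rfl

theorem coe_torus_inv (u : ℂˣ) :
    ((torus u)⁻¹ : SL2C) = (diagonal ![(u : ℂ)⁻¹, (u : ℂ)] : Mat2) := by
  rw [← map_inv, coe_torus, Units.val_inv_eq_inv_val, inv_inv]

/-- The character by which conjugation by the torus acts on the `(a, b)` entry of a matrix. -/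
def weight (a b : Fin 2) : ℤ := !![0, 2; -2, 0] a b

theorem torus_conj_apply (u : ℂˣ) (M : Mat2) (a b : Fin 2) :
    (torus u * M * ((torus u)⁻¹ : SL2C) : Mat2) a b =
      (u : ℂ) ^ weight a b * M a b := by
  rw [coe_torus, coe_torus_inv, mul_diagonal, diagonal_mul]
  fin_cases a <;> fin_cases b <;> simp [weight, zpow_ofNat] <;> field_simp

theorem zpow_weight_eq_one {u : ℂˣ} {a b : Fin 2} (hab : a ≠ b) (h : (u : ℂ) ^ weight a b = 1)
    (c d : Fin 2) : (u : ℂ) ^ weight c d = 1 := by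
  have hu : (u : ℂ) ^ 2 = 1 := by
    fin_cases a <;> fin_cases b <;> simp_all [weight, zpow_ofNat]
  fin_cases c <;> fin_cases d <;> simp [weight, zpow_ofNat, hu]

theorem exists_zpow_weight_eq {a b : Fin 2} (hab : a ≠ b) {w : ℂ} (hw : ‖w‖ = 1) :
    ∃ u : ℂˣ, ‖(u : ℂ)‖ = 1 ∧ (u : ℂ) ^ weight a b = w := by
  obtain ⟨v, hv⟩ := IsAlgClosed.exists_pow_nat_eq w two_pos
  have hv1 : ‖v‖ = 1 := by
    rw [← hv, norm_pow] at hw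
    exact (pow_eq_one_iff_of_nonneg (norm_nonneg v) two_ne_zero).1 hw
  lift v to ℂˣ using (norm_ne_zero_iff.1 (hv1 ▸ one_ne_zero)).isUnit
  fin_cases a <;> fin_cases b <;> first | exact absurd rfl hab | skip
  · exact ⟨v, hv1, hv⟩
  · exact ⟨v⁻¹, by simpa using hv1, by simpa [weight, zpow_ofNat] using hv⟩

theorem torus_mem_SU2 {u : ℂˣ} (hu : ‖(u : ℂ)‖ = 1) : torus u ∈ SU2 := by
  have h : conj (u : ℂ) = (u : ℂ)⁻¹ := eq_inv_of_mul_eq_one_left (conj_mul_self_of_norm_eq_one hu)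
  rw [mem_specialUnitary_iff, coe_torus, diagonal_conjTranspose, diagonal_mul_diagonal,
    diagonal_eq_one]
  ext a
  fin_cases a <;> simp [h]

theorem exists_eq_torus_of_isDiag {k : SU2} (hk : (k : Mat2).IsDiag) :
    ∃ u : ℂˣ, ‖(u : ℂ)‖ = 1 ∧ (k : SL2C) = torus u := by
  have h01 : k.1 0 1 = 0 := hk zero_ne_one
  have h10 : k.1 1 0 = 0 := hk one_ne_zero
  have hdet : k.1 0 0 * k.1 1 1 = 1 := by
    simpa only [det_fin_two, h01, zero_mul, sub_zero] using k.1.det_coe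
  have hnorm : ‖k.1 0 0‖ = 1 := by
    have h := congrFun (congrFun (conjTranspose_mul_self k) 0) 0
    simp only [mul_apply, Fin.sum_univ_two, conjTranspose_apply, h10, RCLike.star_def,
      mul_zero, add_zero, one_apply_eq] at h
    rw [Complex.conj_mul'] at h
    exact (pow_eq_one_iff_of_nonneg (norm_nonneg _) two_ne_zero).1 (mod_cast h)
  refine ⟨Units.mkOfMulEqOne _ _ hdet, hnorm, ?_⟩
  ext a b
  fin_cases a <;> fin_cases b
  · rfl
  · exact h01
  · exact h10
  · exact eq_inv_of_mul_eq_one_right hdet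

variable {ι : Type*}

theorem torus_smul_apply (u : ℂˣ) (A : Tuple ι SL2C) (i : ι) (a b : Fin 2) :
    (torus u • A) i a b = (u : ℂ) ^ weight a b * A i a b :=
  torus_conj_apply u (A i) a b

theorem torus_smul_eq_self {u : ℂˣ} {A : Tuple ι SL2C}
    (h : ∀ i a b, a ≠ b → A i a b ≠ 0 → (u : ℂ) ^ weight a b = 1) : torus u • A = A := by
  funext i
  ext a b
  rw [torus_smul_apply]
  by_cases hA : A i a b = 0
  · rw [hA, mul_zero]
  · obtain rfl | hab := eq_or_ne a b
    · fin_cases a <;> simp [weight]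
    · rw [h i a b hab hA, one_mul]

end Torus

/-! ### The quotient of tuples by `SU(2)` -/

section HermitianPart

open Matrix ComplexConjugate

variable {n : Type*}

/-- Twice the Hermitian part of `c • M`; those for `c = 1` and `c = I` determine `M`. -/
def hermitianPart (c : ℂ) (M : Matrix n n ℂ) : Matrix n n ℂ := c • M + (c • M)ᴴ

theorem isHermitian_hermitianPart (c : ℂ) (M : Matrix n n ℂ) : (hermitianPart c M).IsHermitian :=
  isHermitian_add_transpose_self (c • M)

theorem hermitianPart_conj [Fintype n] (c : ℂ) (M k : Matrix n n ℂ) :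
    hermitianPart c (k * M * kᴴ) = k * hermitianPart c M * kᴴ := by
  simp only [hermitianPart, conjTranspose_smul, conjTranspose_mul, conjTranspose_conjTranspose,
    Matrix.mul_add, Matrix.add_mul, Matrix.mul_smul, Matrix.smul_mul, Matrix.mul_assoc]

theorem continuous_hermitianPart (c : ℂ) : Continuous (hermitianPart (n := n) c) :=
  (continuous_id.const_smul c).add (continuous_id.const_smul c).matrix_conjTranspose

variable [Fintype n] [DecidableEq n]

theorem mem_bot_of_hermitianPart_mem_bot {M : Matrix n n ℂ}
    (h : ∀ c, hermitianPart c M ∈ (⊥ : Subalgebra ℂ (Matrix n n ℂ))) :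
    M ∈ (⊥ : Subalgebra ℂ (Matrix n n ℂ)) := by
  have hM : M = (1 / 2 : ℂ) • hermitianPart 1 M - (Complex.I / 2) • hermitianPart Complex.I M := by
    ext i j
    simp only [hermitianPart, Matrix.sub_apply, Matrix.smul_apply, Matrix.add_apply,
      conjTranspose_apply, smul_eq_mul, star_mul', RCLike.star_def, Complex.conj_I, one_mul]
    linear_combination (1 / 2) * (M i j - conj (M j i)) * Complex.I_sq
  rw [hM]
  exact sub_mem (Subalgebra.smul_mem _ (h 1) _) (Subalgebra.smul_mem _ (h Complex.I) _)

theorem conj_eq_self_of_mem_bot (k : specialUnitary n) {M : Matrix n n ℂ}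
    (hM : M ∈ (⊥ : Subalgebra ℂ (Matrix n n ℂ))) : k * M * (k : Matrix n n ℂ)ᴴ = M := by
  obtain ⟨r, rfl⟩ := Algebra.mem_bot.1 hM
  rw [← Algebra.commutes, Matrix.mul_assoc, mul_conjTranspose_self, Matrix.mul_one]

theorem isClosed_bot_subalgebra :
    IsClosed ((⊥ : Subalgebra ℂ (Matrix n n ℂ)) : Set (Matrix n n ℂ)) :=
  Submodule.closed_of_finiteDimensional (𝕜 := ℂ) (E := Matrix n n ℂ) (Subalgebra.toSubmodule ⊥)

theorem coe_specialUnitary_smul_apply {ι : Type*} (k : specialUnitary n)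
    (A : Tuple ι (Matrix.SpecialLinearGroup n ℂ)) (i : ι) :
    ((k • A) i : Matrix n n ℂ) = k * A i * (k : Matrix n n ℂ)ᴴ := by
  rw [← coe_inv_of_mem_unitaryGroup k.2]
  rfl

theorem hermitianPart_smul_apply {ι : Type*} (c : ℂ) (k : specialUnitary n)
    (A : Tuple ι (Matrix.SpecialLinearGroup n ℂ)) (i : ι) :
    hermitianPart c ((k • A) i : Matrix n n ℂ) =
      k * hermitianPart c (A i : Matrix n n ℂ) * (k : Matrix n n ℂ)ᴴ := by
  rw [coe_specialUnitary_smul_apply, hermitianPart_conj]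

end HermitianPart

section DiagonalSlice

open Matrix ComplexConjugate
open scoped ComplexOrder

/-- A diagonal `2 × 2` matrix whose diagonal entries have decreasing real parts; a normal form for
Hermitian matrices under conjugation by `SU(2)`. -/
def IsDecreasingDiag (M : Mat2) : Prop :=
  M.IsDiag ∧ (M 1 1).re ≤ (M 0 0).re

theorem isClosed_setOf_isDecreasingDiag :
    IsClosed {M : Mat2 | IsDecreasingDiag M} := by
  have hdiag : IsClosed {M : Mat2 | M.IsDiag} := by
    simp only [isDiag_iff_diagonal_diag]
    exact isClosed_eq continuous_id.matrix_diag.matrix_diagonal continuous_id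
  exact hdiag.inter <| isClosed_le (Complex.continuous_re.comp (continuous_apply_apply 1 1))
    (Complex.continuous_re.comp (continuous_apply_apply 0 0))

theorem exists_SU2_conj_isDecreasingDiag {H : Mat2} (hH : H.IsHermitian) :
    ∃ k : SU2, IsDecreasingDiag (k * H * (k : Mat2)ᴴ) := by
  obtain ⟨k, d, hk⟩ := exists_specialUnitary_conj_eq_diagonal hH
  rcases le_total (d 1) (d 0) with h | h
  · exact ⟨k, hk ▸ isDiag_diagonal _, by simpa only [hk, diagonal_apply_eq] using! h⟩
  · let w : SU2 := ⟨⟨!![0, 1; -1, 0], by simp⟩, mem_specialUnitary_iff.2 <| by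
      ext a b; fin_cases a <;> fin_cases b <;> simp [mul_apply]⟩
    have hw : ((w * k : SU2) : Mat2) * H *
        ((w * k : SU2) : Mat2)ᴴ = diagonal ![(d 1 : ℂ), (d 0 : ℂ)] := by
      rw [Subgroup.coe_mul, Matrix.SpecialLinearGroup.coe_mul, conjTranspose_mul]
      calc _ = (w : Mat2) * (k * H * (k : Mat2)ᴴ) *
            (w : Mat2)ᴴ := by simp only [Matrix.mul_assoc]
        _ = _ := by
          rw [hk]
          ext a b
          fin_cases a <;> fin_cases b <;> simp [w, mul_apply, vecMul_diagonal]
    refine ⟨w * k, hw ▸ isDiag_diagonal _, ?_⟩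
    rw [hw]
    exact h

theorem isDiag_of_conj_isDecreasingDiag {H : Mat2} (hH : H.IsHermitian)
    (hscalar : H ∉ (⊥ : Subalgebra ℂ (Mat2))) (hdiag : IsDecreasingDiag H)
    {k : SU2} (hk : IsDecreasingDiag (k * H * (k : Mat2)ᴴ)) :
    (k : Mat2).IsDiag := by
  set K := k * H * (k : Mat2)ᴴ with hK
  have hcomm : K * k = k * H := by
    rw [hK, Matrix.mul_assoc, conjTranspose_mul_self, Matrix.mul_one]
  have htrace : K 0 0 + K 1 1 = H 0 0 + H 1 1 := by
    rw [← trace_fin_two, ← trace_fin_two, hK, trace_mul_cycle, conjTranspose_mul_self,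
      Matrix.one_mul]
  intro a b hab
  by_contra hne
  have hswap : K a a = H b b := by
    refine mul_right_cancel₀ hne ?_
    calc K a a * k.1 a b = (diagonal K.diag * k : Mat2) a b := (diagonal_mul _ _ _ _).symm
      _ = (k * diagonal H.diag : Mat2) a b := by
          rw [hk.1.diagonal_diag, hdiag.1.diagonal_diag, hcomm]
      _ = H b b * k.1 a b := (mul_diagonal _ _ _ _).trans (mul_comm _ _)
  have hle : (H 0 0).re ≤ (H 1 1).re := by
    obtain ⟨h0, h1⟩ : K 0 0 = H 1 1 ∧ K 1 1 = H 0 0 := by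
      obtain ⟨rfl, rfl⟩ | ⟨rfl, rfl⟩ : (a = 0 ∧ b = 1) ∨ (a = 1 ∧ b = 0) := by
        clear * - hab
        decide +revert
      · exact ⟨hswap, by linear_combination htrace - hswap⟩
      · exact ⟨by linear_combination htrace - hswap, hswap⟩
    rw [← h0, ← h1]
    exact hk.2
  have him (a : Fin 2) : (H a a).im = 0 := Complex.conj_eq_iff_im.1 (hH.apply a a)
  have heq : H 0 0 = H 1 1 :=
    Complex.ext (hle.antisymm hdiag.2) ((him 0).trans (him 1).symm)
  refine hscalar (Algebra.mem_bot.2 ⟨H 0 0, ?_⟩)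
  rw [algebraMap_eq_diagonal, ← hdiag.1.diagonal_diag]
  refine congrArg diagonal (funext fun a => ?_)
  fin_cases a
  · exact congrFun (congrFun hdiag.1.diagonal_diag 0) 0
  · exact (congrFun (congrFun hdiag.1.diagonal_diag 0) 0).trans heq

variable {ι : Type*}

/-- The tuples for which the Hermitian part of `c • A i` is in normal form. -/
def diagonalSlice (c : ℂ) (i : ι) : Set (Tuple ι SL2C) :=
  {A | IsDecreasingDiag (hermitianPart c (A i))}

theorem continuous_hermitianPart_apply (c : ℂ) (i : ι) :
    Continuous fun A : Tuple ι SL2C => hermitianPart c (A i : Mat2) :=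
  (continuous_hermitianPart c).comp
    (Matrix.SpecialLinearGroup.isClosedEmbedding_val.continuous.comp (continuous_tuple_apply i))

theorem continuous_tuple_entry (i : ι) (a b : Fin 2) :
    Continuous fun A : Tuple ι SL2C => A i a b :=
  (continuous_apply_apply a b).comp
    (Matrix.SpecialLinearGroup.isClosedEmbedding_val.continuous.comp (continuous_tuple_apply i))

theorem isClosed_diagonalSlice (c : ℂ) (i : ι) : IsClosed (diagonalSlice c i) :=
  isClosed_setOf_isDecreasingDiag.preimage (continuous_hermitianPart_apply c i)

theorem exists_smul_mem_diagonalSlice (c : ℂ) (i : ι) (A : Tuple ι SL2C) :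
    ∃ k : SU2, k • A ∈ diagonalSlice c i := by
  obtain ⟨k, hk⟩ := exists_SU2_conj_isDecreasingDiag (isHermitian_hermitianPart c (A i).1)
  exact ⟨k, by simpa only [diagonalSlice, Set.mem_ofPred_eq, hermitianPart_smul_apply] using hk⟩

theorem exists_eq_torus_of_smul_mem_diagonalSlice {c : ℂ} {i : ι} {A : Tuple ι SL2C}
    (hA : A ∈ diagonalSlice c i)
    (hscalar : hermitianPart c (A i) ∉ (⊥ : Subalgebra ℂ (Mat2))) {k : SU2}
    (hkA : k • A ∈ diagonalSlice c i) : ∃ u : ℂˣ, ‖(u : ℂ)‖ = 1 ∧ (k : SL2C) = torus u := by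
  refine exists_eq_torus_of_isDiag
    (isDiag_of_conj_isDecreasingDiag (isHermitian_hermitianPart c (A i).1) hscalar hA ?_)
  rw [← hermitianPart_smul_apply]
  exact hkA

theorem mapsTo_torus_smul_diagonalSlice (c : ℂ) (i : ι) {u : ℂˣ} (hu : ‖(u : ℂ)‖ = 1) :
    Set.MapsTo (torus u • ·) (diagonalSlice c i) (diagonalSlice c i) := by
  intro A hA
  let k : SU2 := ⟨torus u, torus_mem_SU2 hu⟩
  have hk : hermitianPart c ((k • A) i : Mat2) = hermitianPart c (A i) := by
    rw [hermitianPart_smul_apply, ← coe_inv_of_mem_unitaryGroup k.2]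
    ext a b
    rw [torus_conj_apply]
    obtain rfl | hab := eq_or_ne a b
    · fin_cases a <;> simp [weight]
    · rw [hA.1 hab, mul_zero]
  change IsDecreasingDiag (hermitianPart c ((k • A) i : Mat2))
  rwa [hk]

theorem smul_eq_self_of_mem_positiveSlice {c : ℂ} {i j : ι} {a b : Fin 2} (hab : a ≠ b)
    {A : Tuple ι SL2C} (hA : A ∈ diagonalSlice c i) (hpos : 0 < A j a b)
    (hscalar : hermitianPart c (A i) ∉ (⊥ : Subalgebra ℂ (Mat2))) {k : SU2}
    (hkA : k • A ∈ diagonalSlice c i) (hkpos : 0 ≤ (k • A) j a b) : k • A = A := by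
  obtain ⟨u, hu, hku⟩ := exists_eq_torus_of_smul_mem_diagonalSlice hA hscalar hkA
  have hentry : (k • A) j a b = (u : ℂ) ^ weight a b * A j a b := by
    rw [← torus_smul_apply, ← hku]
    rfl
  have hweight : (u : ℂ) ^ weight a b = 1 := by
    refine mul_right_cancel₀ hpos.ne' ?_
    rw [one_mul, ← hentry, Complex.eq_coe_norm_of_nonneg hkpos, hentry, norm_mul, norm_zpow, hu,
      _root_.one_zpow, one_mul, ← Complex.eq_coe_norm_of_nonneg hpos.le]
  calc k • A = torus u • A := by rw [← hku]; rfl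
    _ = A := torus_smul_eq_self fun _ c d _ _ => zpow_weight_eq_one hab hweight c d

theorem exists_smul_mem_positiveSlice (c : ℂ) (i j : ι) {a b : Fin 2} (hab : a ≠ b)
    (A : Tuple ι SL2C) : ∃ k : SU2, k • A ∈ diagonalSlice c i ∧ 0 ≤ (k • A) j a b := by
  obtain ⟨k, hk⟩ := exists_smul_mem_diagonalSlice c i A
  obtain hz | hz := eq_or_ne ((k • A) j a b) 0
  · exact ⟨k, hk, hz.ge⟩
  obtain ⟨u, hu, hw⟩ := exists_zpow_weight_eq hab
    (w := ‖(k • A) j a b‖ / (k • A) j a b) (by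
      rw [norm_div, Complex.norm_real, norm_norm, div_self (norm_ne_zero_iff.2 hz)])
  refine ⟨⟨torus u, torus_mem_SU2 hu⟩ * k, ?_⟩
  rw [mul_smul]
  refine ⟨mapsTo_torus_smul_diagonalSlice c i hu hk, ?_⟩
  change 0 ≤ (torus u • k • A) j a b
  rw [torus_smul_apply, hw, div_mul_cancel₀ _ hz]
  exact mod_cast norm_nonneg _

variable {V : Set (MulAction.orbitRel.Quotient SU2 (Tuple ι SL2C))}

theorem liftsPaths_of_forall_ne_zero {c : ℂ} {i j : ι} {a b : Fin 2} (hab : a ≠ b)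
    (hscalar : ∀ A : Tuple ι SL2C, toOrbit SU2 A ∈ V →
      hermitianPart c (A i) ∉ (⊥ : Subalgebra ℂ (Mat2)))
    (hne : ∀ A ∈ diagonalSlice c i, toOrbit SU2 A ∈ V → A j a b ≠ 0) :
    LiftsPaths (toOrbit SU2) (diagonalSlice c i) V := by
  have hfix : ∀ A ∈ diagonalSlice c i ∩ {A | 0 ≤ A j a b}, toOrbit SU2 A ∈ V → ∀ k : SU2,
      k • A ∈ diagonalSlice c i ∩ {A | 0 ≤ A j a b} → k • A = A := fun A hA hAV k hk =>
    smul_eq_self_of_mem_positiveSlice hab hA.1 (hA.2.lt_of_ne (hne A hA.1 hAV).symm)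
      (hscalar A hAV) hk.1 hk.2
  have hlift : LiftsPaths (toOrbit SU2) (diagonalSlice c i ∩ {A | 0 ≤ A j a b}) V :=
    .of_slice ((isClosed_diagonalSlice c i).inter
        (isClosed_le continuous_const (continuous_tuple_entry j a b)))
      (fun A _ => exists_smul_mem_positiveSlice c i j hab A)
      (fun A hA hAV k hk => ⟨1, by simpa only [one_smul] using! Set.mapsTo_id _,
        by rw [one_smul, hfix A hA hAV k hk]⟩)
      fun A hA hAV => Or.inr (hfix A hA hAV)
  exact hlift.mono Set.inter_subset_left subset_rfl

theorem liftsPaths_diagonalSlice {c : ℂ} {i : ι} (hV : IsOpen V)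
    (hscalar : ∀ A : Tuple ι SL2C, toOrbit SU2 A ∈ V →
      hermitianPart c (A i) ∉ (⊥ : Subalgebra ℂ (Mat2))) :
    LiftsPaths (toOrbit SU2) (diagonalSlice c i) V := by
  refine .of_slice (isClosed_diagonalSlice c i) (fun A _ => exists_smul_mem_diagonalSlice c i A)
    (fun A hA hAV k hk => ?_) fun A hA hAV => ?_
  · obtain ⟨u, hu, hku⟩ := exists_eq_torus_of_smul_mem_diagonalSlice hA (hscalar A hAV) hk
    refine ⟨k, ?_, rfl⟩
    change Set.MapsTo ((k : SL2C) • ·) _ _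
    exact hku ▸ mapsTo_torus_smul_diagonalSlice c i hu
  by_cases hoff : ∀ j a b, a ≠ b → A j a b = 0
  · refine Or.inr fun k hk => ?_
    obtain ⟨u, -, hku⟩ := exists_eq_torus_of_smul_mem_diagonalSlice hA (hscalar A hAV) hk
    change (k : SL2C) • A = A
    rw [hku]
    exact torus_smul_eq_self fun j a b hab hne => absurd (hoff j a b hab) hne
  · push Not at hoff
    obtain ⟨j, a, b, hab, hne⟩ := hoff
    have hU : IsOpen {B : Tuple ι SL2C | B j a b ≠ 0} :=
      isOpen_ne_fun (continuous_tuple_entry j a b) continuous_const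
    have hnhds := upperHemicontinuousAt_iff_forall_isOpen.1
      (upperHemicontinuous_toOrbit_fiber_inter (isClosed_diagonalSlice c i) (toOrbit SU2 A)) _ hU ?_
    · refine Or.inl ⟨_, (hV.eventually_mem hAV).and hnhds, liftsPaths_of_forall_ne_zero hab
        (fun B hB => hscalar B hB.1) fun B hB hBV => hBV.2 ⟨rfl, hB⟩⟩
    · rintro B ⟨hBA, hB⟩
      obtain ⟨k, rfl⟩ := toOrbit_eq_iff.1 (Eq.symm hBA)
      obtain ⟨u, -, hku⟩ := exists_eq_torus_of_smul_mem_diagonalSlice hA (hscalar A hAV) hB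
      change ((k : SL2C) • A) j a b ≠ 0
      rw [hku, torus_smul_apply]
      exact mul_ne_zero (zpow_ne_zero _ u.ne_zero) hne

theorem liftsPaths_toOrbit_SU2 :
    LiftsPaths (toOrbit SU2 (X := Tuple ι SL2C)) Set.univ Set.univ := by
  refine .of_slice isClosed_univ (fun _ _ => ⟨1, trivial⟩)
    (fun _ _ _ k _ => ⟨k, Set.mapsTo_univ _ _, rfl⟩) fun A _ _ => ?_
  by_cases hscalar : ∀ i c,
    hermitianPart c (A i) ∈ (⊥ : Subalgebra ℂ (Mat2))
  · refine Or.inr fun k _ => funext fun i => Subtype.ext ?_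
    rw [coe_specialUnitary_smul_apply,
      conj_eq_self_of_mem_bot k (mem_bot_of_hermitianPart_mem_bot (hscalar i))]
  · push Not at hscalar
    obtain ⟨i, c, hscalar⟩ := hscalar
    have hU : IsOpen {B : Tuple ι SL2C |
        hermitianPart c (B i) ∉ (⊥ : Subalgebra ℂ (Mat2))} :=
      (isClosed_bot_subalgebra.preimage (continuous_hermitianPart_apply c i)).isOpen_compl
    obtain ⟨V, hVU, hV, hAV⟩ := eventually_nhds_iff.1 <| upperHemicontinuousAt_iff_forall_isOpen.1
      (upperHemicontinuous_toOrbit_fiber_inter isClosed_univ (toOrbit SU2 A)) _ hU <| by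
        rintro B ⟨hBA, -⟩ hB
        obtain ⟨k, rfl⟩ := toOrbit_eq_iff.1 hBA
        rw [hermitianPart_smul_apply, conj_eq_self_of_mem_bot k hB] at hscalar
        exact hscalar hB
    exact Or.inl ⟨V, hV.mem_nhds hAV, (liftsPaths_diagonalSlice (c := c) (i := i) hV fun B hB =>
      hVU _ hB ⟨rfl, trivial⟩).mono (Set.subset_univ _) subset_rfl⟩

end DiagonalSlice

/-! ### Tuples of minimal energy -/

section Energy

open Matrix

variable {ι n : Type*} [Fintype ι] [Fintype n] [DecidableEq n]

/-- The sum of the squared Frobenius norms of the entries of a tuple, which plays the role of the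
norm function of Kempf and Ness. -/
def energy (A : Tuple ι (Matrix.SpecialLinearGroup n ℂ)) : ℝ :=
  ∑ i, frobeniusSq (A i : Matrix n n ℂ)

theorem continuous_energy :
    Continuous (energy : Tuple ι (Matrix.SpecialLinearGroup n ℂ) → ℝ) :=
  continuous_finsetSum _ fun i _ => continuous_frobeniusSq.comp <|
    Matrix.SpecialLinearGroup.isClosedEmbedding_val.continuous.comp (continuous_tuple_apply i)

theorem isCompact_setOf_energy_le (c : ℝ) :
    IsCompact {A : Tuple ι (Matrix.SpecialLinearGroup n ℂ) | energy A ≤ c} := by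
  have hcompact : IsCompact {g : Matrix.SpecialLinearGroup n ℂ | frobeniusSq g.1 ≤ c} :=
    Matrix.SpecialLinearGroup.isClosedEmbedding_val.isCompact_preimage
      (isCompact_setOf_frobeniusSq_le c)
  refine (isCompact_univ_pi fun _ : ι => hcompact).of_isClosed_subset
    (isClosed_le continuous_energy continuous_const) fun A hA i _ => ?_
  exact (Finset.single_le_sum (f := fun i => frobeniusSq (A i : Matrix n n ℂ))
    (fun _ _ => frobeniusSq_nonneg _) (Finset.mem_univ i)).trans hA

theorem energy_specialUnitary_smul (k : specialUnitary n)
    (A : Tuple ι (Matrix.SpecialLinearGroup n ℂ)) : energy (k • A) = energy A :=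
  Finset.sum_congr rfl fun i _ => by
    rw [coe_specialUnitary_smul_apply, ← star_eq_conjTranspose,
      frobeniusSq_mul_unitary (Unitary.star_mem k.2),
      frobeniusSq_unitary_mul k.2]

theorem energy_central_smul [Nonempty n] (z : CentralTuple ι (Matrix.SpecialLinearGroup n ℂ))
    (A : Tuple ι (Matrix.SpecialLinearGroup n ℂ)) : energy (z • A) = energy A :=
  Finset.sum_congr rfl fun i _ =>
    frobeniusSq_unitary_mul (center_le_specialUnitary (z i).2) (A i : Matrix n n ℂ)

/-- The tuple minimizes the energy in its conjugacy class. By Kempf–Ness, these tuples represent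
the closed conjugacy classes, each of them by a single orbit of the special unitary group. -/
def IsMinimal (A : Tuple ι (Matrix.SpecialLinearGroup n ℂ)) : Prop :=
  ∀ g : Matrix.SpecialLinearGroup n ℂ, energy A ≤ energy (g • A)

theorem isClosed_setOf_isMinimal :
    IsClosed {A : Tuple ι (Matrix.SpecialLinearGroup n ℂ) | IsMinimal A} := by
  simp only [IsMinimal, Set.ofPred_forall]
  exact isClosed_iInter fun g =>
    isClosed_le continuous_energy (continuous_energy.comp (continuous_const_smul g))

theorem IsMinimal.specialUnitary_smul {A : Tuple ι (Matrix.SpecialLinearGroup n ℂ)}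
    (hA : IsMinimal A) (k : specialUnitary n) : IsMinimal (k • A) := fun g => by
  rw [energy_specialUnitary_smul, Subgroup.smul_def, ← mul_smul]
  exact hA _

theorem IsMinimal.central_smul [Nonempty n] {A : Tuple ι (Matrix.SpecialLinearGroup n ℂ)}
    (hA : IsMinimal A) (z : CentralTuple ι (Matrix.SpecialLinearGroup n ℂ)) :
    IsMinimal (z • A) := fun g => by
  rw [energy_central_smul, ← smul_comm, energy_central_smul]
  exact hA g

theorem exists_isMinimal_mem_closure (A : Tuple ι (Matrix.SpecialLinearGroup n ℂ)) :
    ∃ B, IsMinimal B ∧ B ∈ closure (centralConjOrbit A) ∧ energy B ≤ energy A := by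
  have hcompact : IsCompact (closure (centralConjOrbit A) ∩ {B | energy B ≤ energy A}) :=
    (isCompact_setOf_energy_le _).inter_left isClosed_closure
  obtain ⟨B, ⟨hB, hBA⟩, hmin⟩ := hcompact.exists_isMinOn
    ⟨A, subset_closure (self_mem_centralConjOrbit A), le_refl (energy A)⟩
    continuous_energy.continuousOn
  refine ⟨B, fun g => ?_, hB, hBA⟩
  obtain hg | hg := le_total (energy (g • B)) (energy A)
  · refine hmin ⟨?_, hg⟩
    simpa only [one_smul] using smul_smul_mem_closure_centralConjOrbit hB 1 g
  · exact le_trans hBA hg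

end Energy

section Boost

open Matrix ComplexConjugate

/-- The one-parameter group of diagonal matrices with entries `exp t` and `exp (-t)`. -/
def boost (t : ℝ) : SL2C := torus (Units.mk0 (Real.exp t : ℂ) (mod_cast (Real.exp_pos t).ne'))

theorem coe_boost_inv (t : ℝ) :
    ((boost t)⁻¹ : SL2C) = (diagonal ![(Real.exp (-t) : ℂ), (Real.exp t : ℂ)] : Mat2) := by
  rw [boost, coe_torus_inv, Units.val_mk0, Real.exp_neg, Complex.ofReal_inv]

theorem exists_eq_mul_boost_of_conjTranspose_mul_self {h : SL2C} {d : Fin 2 → ℝ}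
    (hd : (h : Mat2)ᴴ * h = diagonal fun i => (d i : ℂ)) :
    ∃ (k : SU2) (t : ℝ), h = k * boost t := by
  have hdet : d 0 * d 1 = 1 := by
    have := congrArg det hd
    rw [det_mul, det_conjTranspose, h.det_coe, star_one, one_mul, det_diagonal,
      Fin.prod_univ_two] at this
    exact_mod_cast this.symm
  have hpos : 0 < d 0 := by
    have hnonneg : 0 ≤ d 0 := by
      have := congrArg Complex.re (congrFun (congrFun hd 0) 0)
      simp only [mul_apply, conjTranspose_apply, RCLike.star_def, Complex.conj_mul',
        Fin.sum_univ_two, diagonal_apply_eq, Complex.ofReal_re] at this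
      rw [← this]
      norm_cast
      positivity
    exact hnonneg.lt_of_ne' (left_ne_zero_of_mul_eq_one hdet)
  obtain ⟨t, ht⟩ : ∃ t, Real.exp t * Real.exp t = d 0 :=
    ⟨Real.log (d 0) / 2, by rw [← Real.exp_add, add_halves, Real.exp_log hpos]⟩
  have hexp : Real.exp t * Real.exp (-t) = 1 := by
    rw [← Real.exp_add, add_neg_cancel, Real.exp_zero]
  have h0 : Real.exp (-t) * d 0 * Real.exp (-t) = 1 := by
    rw [← ht]
    linear_combination (Real.exp t * Real.exp (-t) + 1) * hexp
  have h1 : Real.exp t * d 1 * Real.exp t = 1 := by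
    rw [← hdet, ← ht]
    ring
  refine ⟨⟨h * (boost t)⁻¹, mem_specialUnitary_iff.2 ?_⟩, t, by simp⟩
  calc ((h * (boost t)⁻¹ : SL2C) : Mat2)ᴴ * ((h * (boost t)⁻¹ : SL2C) : Mat2)
      = (((boost t)⁻¹ : SL2C) : Mat2)ᴴ * ((h : Mat2)ᴴ * h) * ((boost t)⁻¹ : SL2C) := by
        simp only [Matrix.SpecialLinearGroup.coe_mul, conjTranspose_mul, Matrix.mul_assoc]
    _ = 1 := by
        rw [hd, coe_boost_inv, diagonal_conjTranspose, diagonal_mul_diagonal,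
          diagonal_mul_diagonal, diagonal_eq_one]
        ext a
        fin_cases a
        · simpa [-Complex.ofReal_exp] using! congrArg Complex.ofReal h0
        · simpa [-Complex.ofReal_exp] using! congrArg Complex.ofReal h1

theorem exists_cartan_decomposition (g : SL2C) :
    ∃ (k u : SU2) (t : ℝ), g = k * boost t * u := by
  obtain ⟨u, d, hd⟩ :=
    exists_specialUnitary_conj_eq_diagonal (isHermitian_conjTranspose_mul_self (g : Mat2))
  obtain ⟨k, t, hk⟩ := exists_eq_mul_boost_of_conjTranspose_mul_self (h := g * (u : SL2C)⁻¹) <| by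
    rw [← hd, Matrix.SpecialLinearGroup.coe_mul, coe_inv_of_mem_unitaryGroup u.2, conjTranspose_mul,
      conjTranspose_conjTranspose]
    simp only [Matrix.mul_assoc]
  exact ⟨k, u, t, by rw [← hk, inv_mul_cancel_right]⟩

theorem sq_exp_sub_one_le (t : ℝ) (w : ℤ) : (Real.exp (t * w) - 1) ^ 2 ≤
    SignType.sign t * (w * (Real.exp (t * w) ^ 2 - 1)) := by
  wlog ht : 0 ≤ t generalizing t w
  · simpa [Left.sign_neg] using this (-t) (-w) (by linarith)
  obtain rfl | ht := ht.eq_or_lt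
  · simp
  rw [sign_pos ht, SignType.coe_one, one_mul]
  have hexp := Real.exp_pos (t * w)
  obtain hw | rfl | hw := lt_trichotomy w 0
  · have hw' : (w : ℝ) ≤ -1 := mod_cast Int.le_sub_one_of_lt hw
    have hle : Real.exp (t * w) ≤ 1 := Real.exp_le_one_iff.2 (by nlinarith)
    nlinarith [mul_nonneg (sub_nonneg.2 hle) hexp.le]
  · simp
  · have hw' : (1 : ℝ) ≤ w := mod_cast hw
    have hle : 1 ≤ Real.exp (t * w) := Real.one_le_exp (by positivity)
    nlinarith [mul_nonneg (sub_nonneg.2 hle) hexp.le]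

variable {ι : Type*}

theorem boost_smul_apply (t : ℝ) (A : Tuple ι SL2C) (i : ι) (a b : Fin 2) :
    (boost t • A) i a b = (Real.exp (t * weight a b) : ℂ) * A i a b := by
  rw [boost, torus_smul_apply, Units.val_mk0, Real.exp_mul, Real.rpow_intCast, Complex.ofReal_zpow]

variable [Fintype ι]

/-- The sum of the squared norms of the `(a, b)` entries of the matrices in a tuple. -/
def entrySq (a b : Fin 2) (A : Tuple ι SL2C) : ℝ := ∑ i, ‖A i a b‖ ^ 2

theorem energy_eq_sum_entrySq (A : Tuple ι SL2C) : energy A = ∑ a, ∑ b, entrySq a b A := by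
  simp only [energy, entrySq, frobeniusSq]
  rw [Finset.sum_comm]
  exact Finset.sum_congr rfl fun a _ => Finset.sum_comm

theorem continuous_entrySq (a b : Fin 2) :
    Continuous (entrySq a b : Tuple ι SL2C → ℝ) :=
  continuous_finsetSum _ fun i _ => (continuous_tuple_entry i a b).norm.pow 2

theorem sq_norm_le_entrySq (A : Tuple ι SL2C) (i : ι) (a b : Fin 2) :
    ‖A i a b‖ ^ 2 ≤ entrySq a b A :=
  Finset.single_le_sum (f := fun i => ‖A i a b‖ ^ 2) (fun _ _ => sq_nonneg _) (Finset.mem_univ i)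

theorem entrySq_nonneg (a b : Fin 2) (A : Tuple ι SL2C) : 0 ≤ entrySq a b A :=
  Finset.sum_nonneg fun _ _ => sq_nonneg _

theorem entrySq_boost_smul (a b : Fin 2) (t : ℝ) (A : Tuple ι SL2C) :
    entrySq a b (boost t • A) = Real.exp (t * weight a b) ^ 2 * entrySq a b A := by
  simp only [entrySq, boost_smul_apply, norm_mul, mul_pow, Finset.mul_sum, Complex.norm_real,
    Real.norm_eq_abs, sq_abs]

/-- Half the derivative of the energy along `boost`: the component of the moment map of Kempf and
Ness in the direction of the torus. -/
def moment (A : Tuple ι SL2C) : ℝ := ∑ a, ∑ b, weight a b * entrySq a b A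

theorem continuous_moment : Continuous (moment : Tuple ι SL2C → ℝ) :=
  continuous_finsetSum _ fun a _ => continuous_finsetSum _ fun b _ =>
    continuous_const.mul (continuous_entrySq a b)

theorem hasDerivAt_energy_boost_smul (A : Tuple ι SL2C) :
    HasDerivAt (fun t => energy (boost t • A)) (2 * moment A) 0 := by
  simp only [energy_eq_sum_entrySq, entrySq_boost_smul, moment, Finset.mul_sum]
  refine HasDerivAt.fun_sum fun a _ => HasDerivAt.fun_sum fun b _ => ?_
  have h := (((hasDerivAt_id (0 : ℝ)).mul_const (weight a b : ℝ)).exp.pow 2).mul_const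
    (entrySq a b A)
  simpa [mul_assoc] using h

theorem IsMinimal.moment_eq_zero {A : Tuple ι SL2C} (hA : IsMinimal A) : moment A = 0 := by
  have hmin : IsLocalMin (fun t => energy (boost t • A)) 0 := by
    have hboost : boost 0 • A = A := by
      funext i
      ext a b
      simp [boost_smul_apply]
    refine Eventually.of_forall fun t => ?_
    simpa only [hboost] using hA (boost t)
  linarith [hmin.hasDerivAt_eq_zero (hasDerivAt_energy_boost_smul A)]

theorem sq_norm_boost_smul_sub_le (t : ℝ) (A : Tuple ι SL2C) (i : ι) (a b : Fin 2) :
    ‖(boost t • A) i a b - A i a b‖ ^ 2 ≤ |moment (boost t • A) - moment A| := by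
  let defect (a b : Fin 2) : ℝ := (Real.exp (t * weight a b) - 1) ^ 2 * entrySq a b A
  have hnorm (x : ℝ) : ‖(x : ℂ) - 1‖ = |x - 1| := mod_cast Complex.norm_real (x - 1)
  have hnonneg (a b : Fin 2) : 0 ≤ defect a b := mul_nonneg (sq_nonneg _) (entrySq_nonneg a b A)
  calc ‖(boost t • A) i a b - A i a b‖ ^ 2
      = (Real.exp (t * weight a b) - 1) ^ 2 * ‖A i a b‖ ^ 2 := by
        rw [boost_smul_apply, ← sub_one_mul, norm_mul, mul_pow, hnorm, sq_abs]
    _ ≤ defect a b := mul_le_mul_of_nonneg_left (sq_norm_le_entrySq A i a b) (sq_nonneg _)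
    _ ≤ ∑ a, ∑ b, defect a b :=
        (Finset.single_le_sum (fun b _ => hnonneg a b) (Finset.mem_univ b)).trans
          (Finset.single_le_sum (f := fun a => ∑ b, defect a b)
            (fun a _ => Finset.sum_nonneg fun b _ => hnonneg a b) (Finset.mem_univ a))
    _ ≤ ∑ a, ∑ b, SignType.sign t * (weight a b * (Real.exp (t * weight a b) ^ 2 - 1)) *
          entrySq a b A := by
        gcongr with a _ b _
        exact mul_le_mul_of_nonneg_right (sq_exp_sub_one_le t _) (entrySq_nonneg a b A)
    _ = SignType.sign t * (moment (boost t • A) - moment A) := by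
        simp only [moment, entrySq_boost_smul, ← Finset.sum_sub_distrib, Finset.mul_sum]
        exact Finset.sum_congr rfl fun a _ => Finset.sum_congr rfl fun b _ => by ring
    _ ≤ |moment (boost t • A) - moment A| := by
        obtain h | h | h : SignType.sign t = 1 ∨ SignType.sign t = 0 ∨ SignType.sign t = -1 := by
          cases SignType.sign t <;> decide
        · rw [h, SignType.coe_one, one_mul]
          exact le_abs_self _
        · rw [h, SignType.coe_zero, zero_mul]
          exact abs_nonneg _
        · rw [h, SignType.coe_neg_one, neg_one_mul]
          exact neg_le_abs _

theorem eq_of_tendsto_boost_smul {J : Type*} {l : Filter J} [l.NeBot] {A : J → Tuple ι SL2C}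
    {t : J → ℝ} {B C : Tuple ι SL2C} (hB : IsMinimal B) (hC : IsMinimal C)
    (hAB : Tendsto A l (𝓝 B)) (hAC : Tendsto (fun j => boost (t j) • A j) l (𝓝 C)) : C = B := by
  have hmoment : Tendsto (fun j => |moment (boost (t j) • A j) - moment (A j)|) l (𝓝 0) := by
    have h := (((continuous_moment.tendsto C).comp hAC).sub
      ((continuous_moment.tendsto B).comp hAB)).abs
    rwa [hB.moment_eq_zero, hC.moment_eq_zero, sub_self, abs_zero] at h
  funext i
  ext a b
  have hdiff : Tendsto (fun j => ‖(boost (t j) • A j) i a b - A j i a b‖ ^ 2) l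
      (𝓝 (‖C i a b - B i a b‖ ^ 2)) :=
    ((((continuous_tuple_entry i a b).tendsto C).comp hAC).sub
      (((continuous_tuple_entry i a b).tendsto B).comp hAB)).norm.pow 2
  have hzero := tendsto_nhds_unique hdiff
    (squeeze_zero (fun _ => sq_nonneg _) (fun j => sq_norm_boost_smul_sub_le _ _ i a b) hmoment)
  exact sub_eq_zero.1 (norm_eq_zero.1 (pow_eq_zero_iff two_ne_zero |>.1 hzero))

theorem IsMinimal.exists_smul_eq_of_tendsto {J : Type*} {l : Ultrafilter J} {A : J → Tuple ι SL2C}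
    {g : J → SL2C} {B C : Tuple ι SL2C} (hB : IsMinimal B) (hC : IsMinimal C)
    (hAB : Tendsto A l (𝓝 B)) (hAC : Tendsto (fun j => g j • A j) l (𝓝 C)) :
    ∃ k : SU2, k • B = C := by
  choose k u t hg using fun j => exists_cartan_decomposition (g j)
  have hlim (k : J → SU2) : ∃ k₀, Tendsto k l (𝓝 k₀) := ⟨_, (l.map k).le_nhds_lim⟩
  obtain ⟨k₀, hk₀⟩ := hlim k
  obtain ⟨u₀, hu₀⟩ := hlim u
  have hboost : Tendsto (fun j => boost (t j) • u j • A j) l (𝓝 (k₀⁻¹ • C)) := by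
    refine (hk₀.inv.smul hAC).congr fun j => ?_
    rw [hg j, mul_smul, mul_smul]
    exact inv_smul_smul (k j) _
  have heq := eq_of_tendsto_boost_smul (hB.specialUnitary_smul u₀) (hC.specialUnitary_smul k₀⁻¹)
    (hu₀.smul hAB) hboost
  exact ⟨k₀ * u₀, by rw [mul_smul, ← heq, smul_inv_smul]⟩

instance : Finite (Subgroup.center SL2C) :=
  have : NeZero (max (Fintype.card (Fin 2)) 1) := ⟨by simp⟩
  Finite.of_equiv _
    (Matrix.SpecialLinearGroup.center_equiv_rootsOfUnity (n := Fin 2) (R := ℂ)).symm.toEquiv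

theorem IsMinimal.exists_smul_smul_eq_of_mem_closure {B C : Tuple ι SL2C} (hB : IsMinimal B)
    (hC : IsMinimal C) (h : (B, C) ∈ closure {x : Tuple ι SL2C × Tuple ι SL2C |
      x.2 ∈ centralConjOrbit x.1}) :
    ∃ (z : CentralTuple ι SL2C) (k : SU2), z • k • B = C := by
  obtain ⟨l, hl, hBC⟩ := mem_closure_iff_ultrafilter.1 h
  have hfst : Tendsto Prod.fst (l : Filter (Tuple ι SL2C × Tuple ι SL2C)) (𝓝 B) :=
    (continuous_fst.tendsto (B, C)).mono_left hBC
  have hsnd : Tendsto Prod.snd (l : Filter (Tuple ι SL2C × Tuple ι SL2C)) (𝓝 C) :=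
    (continuous_snd.tendsto (B, C)).mono_left hBC
  have hconj : ∀ᶠ x in (l : Filter (Tuple ι SL2C × Tuple ι SL2C)),
      ∃ (z : CentralTuple ι SL2C) (g : SL2C), z • g • x.1 = x.2 := hl
  obtain ⟨z, hz⟩ := Ultrafilter.eventually_exists_iff.1 hconj
  obtain ⟨g, hg⟩ := hz.choice
  have hsmul : Tendsto (fun x => g x • x.1)
      (l : Filter (Tuple ι SL2C × Tuple ι SL2C)) (𝓝 (z⁻¹ • C)) := by
    refine (((continuous_const_smul z⁻¹).tendsto C).comp hsnd).congr' (hg.mono fun x hx => ?_)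
    exact inv_smul_eq_iff.2 hx.symm
  obtain ⟨k, hk⟩ := hB.exists_smul_eq_of_tendsto (hC.central_smul z⁻¹) hfst hsmul
  exact ⟨z, k, by rw [hk, smul_inv_smul]⟩

theorem IsMinimal.mem_closure_centralConjOrbit_iff {A B C : Tuple ι SL2C} (hA : IsMinimal A)
    (h : C ∈ closure (centralConjOrbit B)) :
    A ∈ closure (centralConjOrbit B) ↔ A ∈ closure (centralConjOrbit C) := by
  refine ⟨fun hAB => ?_, fun hAC => closure_centralConjOrbit_subset h hAC⟩
  obtain ⟨D, hD, hDC, -⟩ := exists_isMinimal_mem_closure C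
  obtain ⟨z, k, rfl⟩ := hD.exists_smul_smul_eq_of_mem_closure hA <|
    mk_mem_closure_setOf_mem_centralConjOrbit
      (subset_closure (closure_centralConjOrbit_subset h hDC)) hAB
  exact smul_smul_mem_closure_centralConjOrbit hDC z k

theorem IsMinimal.energy_le_of_mem_closure {A X : Tuple ι SL2C} (hA : IsMinimal A)
    (hAX : A ∈ closure (centralConjOrbit X)) : energy A ≤ energy X := by
  obtain ⟨B, hB, hBX, hle⟩ := exists_isMinimal_mem_closure X
  obtain ⟨z, k, rfl⟩ := hB.exists_smul_smul_eq_of_mem_closure hA <|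
    mk_mem_closure_setOf_mem_centralConjOrbit (subset_closure hBX) hAX
  rwa [energy_central_smul, energy_specialUnitary_smul]

theorem isClosed_setOf_exists_isMinimal_mem_closure {C : Set (Tuple ι SL2C)} (hC : IsClosed C) :
    IsClosed {X | ∃ A ∈ C, IsMinimal A ∧ A ∈ closure (centralConjOrbit X)} := by
  refine isClosed_iff_ultrafilter.2 fun X l hlX hl => ?_
  have : Nonempty (Tuple ι SL2C) := ⟨X⟩
  choose! c hcC hcmin hcX using fun Y (hY : Y ∈ {Y : Tuple ι SL2C |
    ∃ A ∈ C, IsMinimal A ∧ A ∈ closure (centralConjOrbit Y)}) => hY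
  have hcompact : IsCompact ({A : Tuple ι SL2C | energy A ≤ energy X + 1} ∩
      (C ∩ {A | IsMinimal A})) :=
    (isCompact_setOf_energy_le _).inter_right (hC.inter isClosed_setOf_isMinimal)
  have henergy : ∀ᶠ Y in (l : Filter (Tuple ι SL2C)), energy Y < energy X + 1 :=
    hlX (continuous_energy.continuousAt.eventually_lt_const (lt_add_one _))
  obtain ⟨A, ⟨-, hAC, hA⟩, hlA⟩ := hcompact.ultrafilter_le_nhds (l.map c) <| by
    refine le_principal_iff.2 (mem_map.2 ?_)
    filter_upwards [henergy, hl] with Y hY hYl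
    exact ⟨((hcmin Y hYl).energy_le_of_mem_closure (hcX Y hYl)).trans hY.le, hcC Y hYl, hcmin Y hYl⟩
  have hcA : Tendsto c (l : Filter (Tuple ι SL2C)) (𝓝 A) := hlA
  have hAX : (A, X) ∈ closure {x : Tuple ι SL2C × Tuple ι SL2C |
      x.1 ∈ closure (centralConjOrbit x.2)} :=
    mem_closure_of_tendsto (hcA.prodMk_nhds (tendsto_id'.2 hlX)) (mem_of_superset hl hcX)
  obtain ⟨B, hB, hBX, -⟩ := exists_isMinimal_mem_closure X
  obtain ⟨z, k, hzk⟩ := hA.exists_smul_smul_eq_of_mem_closure hB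
    (mk_mem_closure_setOf_mem_centralConjOrbit hAX hBX)
  exact ⟨A, hAC, hA, closure_centralConjOrbit_subset hBX
    (subset_closure (mem_centralConjOrbit_symm ⟨z, k, hzk⟩))⟩

end Boost

/-! ### Representations of finitely generated groups -/

section Generators

variable {ι Γ G : Type*} [Group Γ] [Group G] {φ : FreeGroup ι →* Γ}

/-- The values of a representation at the generators given by a homomorphism from a free group. -/
def evalGenerators (φ : FreeGroup ι →* Γ) (ρ : Γ →* G) (i : ι) : G := ρ (φ (FreeGroup.of i))

theorem lift_evalGenerators (ρ : Γ →* G) (w : FreeGroup ι) :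
    FreeGroup.lift (evalGenerators φ ρ) w = ρ (φ w) :=
  DFunLike.congr_fun (FreeGroup.ext_hom (f := FreeGroup.lift (evalGenerators φ ρ))
    (g := ρ.comp φ) fun _ => FreeGroup.lift_apply_of) w

theorem evalGenerators_injective (hφ : Function.Surjective φ) :
    Function.Injective (evalGenerators φ (G := G)) := fun ρ ρ' h => by
  ext γ
  obtain ⟨w, rfl⟩ := hφ γ
  rw [← lift_evalGenerators, h, lift_evalGenerators]

theorem mem_range_evalGenerators_iff (hφ : Function.Surjective φ) {x : ι → G} :
    x ∈ Set.range (evalGenerators φ) ↔ ∀ w ∈ φ.ker, FreeGroup.lift x w = 1 := by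
  constructor
  · rintro ⟨ρ, rfl⟩ w hw
    rw [lift_evalGenerators, MonoidHom.mem_ker.1 hw, map_one]
  · refine fun h => ⟨φ.liftOfSurjective hφ ⟨FreeGroup.lift x, h⟩, funext fun i => ?_⟩
    exact (φ.liftOfRightInverse_comp_apply _ (Function.rightInverse_surjInv hφ)
      ⟨FreeGroup.lift x, h⟩ (FreeGroup.of i)).trans FreeGroup.lift_apply_of

variable [TopologicalSpace G] [IsTopologicalGroup G]

theorem continuous_freeGroup_lift_apply (w : FreeGroup ι) :
    Continuous fun x : ι → G => FreeGroup.lift x w := by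
  induction w using FreeGroup.induction_on with
  | C1 => simpa only [map_one] using continuous_const
  | of i => simpa only [FreeGroup.lift_apply_of] using continuous_apply i
  | inv_of i h => simpa only [map_inv] using! h.inv
  | mul v w hv hw => simpa only [map_mul] using! hv.mul hw

theorem isClosed_range_evalGenerators [T1Space G] (hφ : Function.Surjective φ) :
    IsClosed (Set.range (evalGenerators φ (G := G))) := by
  have h : Set.range (evalGenerators φ (G := G)) =
      ⋂ w ∈ φ.ker, (FreeGroup.lift · w) ⁻¹' {1} := by
    ext x
    simp only [mem_range_evalGenerators_iff hφ, Set.mem_iInter, Set.mem_preimage,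
      Set.mem_singleton_iff]
  rw [h]
  exact isClosed_biInter fun w _ =>
    isClosed_singleton.preimage (continuous_freeGroup_lift_apply w)

end Generators

/-! ### Lifting representations to tuples of matrices -/

section Lifts

variable {ι Γ : Type*} [Group Γ] {φ : FreeGroup ι →* Γ}

theorem isInducing_evalGenerators (hφ : Function.Surjective φ) :
    IsInducing fun ρ : RepresentationVariety Γ => evalGenerators φ ρ := by
  have hcoe : IsInducing fun (ρ : RepresentationVariety Γ) (γ : Γ) => ρ γ := ⟨rfl⟩
  obtain ⟨s, hs⟩ := hφ.hasRightInverse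
  have hlift : Continuous fun (x : ι → PSL2C) (γ : Γ) => FreeGroup.lift x (s γ) :=
    continuous_pi fun γ => continuous_freeGroup_lift_apply (s γ)
  refine .of_comp (continuous_pi fun i => ?_) hlift ?_
  · exact (continuous_apply (φ (FreeGroup.of i))).comp hcoe.continuous
  · simpa only [Function.comp_def, lift_evalGenerators, hs _] using hcoe

theorem isQuotientMap_toCharacterVariety : IsQuotientMap (toCharacterVariety (Γ := Γ)) :=
  isQuotientMap_quot_mk

instance : T1Space PSL2C :=
  QuotientGroup.t1Space_iff.2
    (Set.finite_coe_iff.1 (inferInstanceAs (Finite (Subgroup.center SL2C)))).isClosed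

/-- The tuple of elements of `PSL(2, ℂ)` represented by a tuple of matrices. -/
def toPSL (A : Tuple ι SL2C) : ι → PSL2C := fun i => (QuotientGroup.mk (A i) : PSL2C)

theorem toPSL_eq_iff {A B : Tuple ι SL2C} :
    toPSL A = toPSL B ↔ ∃ z : CentralTuple ι SL2C, z • A = B := by
  have hcomm (z : Subgroup.center SL2C) (g : SL2C) : z * g = g * z :=
    (Subgroup.mem_center_iff.1 z.2 g).symm
  constructor
  · intro h
    have hmem (i : ι) : (A i)⁻¹ * B i ∈ Subgroup.center SL2C := QuotientGroup.eq.1 (congrFun h i)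
    refine ⟨fun i => ⟨_, hmem i⟩, funext fun i => ?_⟩
    rw [central_smul_apply, hcomm, mul_inv_cancel_left]
  · rintro ⟨z, rfl⟩
    refine funext fun i => QuotientGroup.eq.2 ?_
    rw [central_smul_apply, hcomm, inv_mul_cancel_left]
    exact (z i).2

theorem isOpenQuotientMap_toPSL : IsOpenQuotientMap (toPSL (ι := ι)) :=
  IsOpenQuotientMap.piMap (f := fun (_ : ι) (g : SL2C) => (QuotientGroup.mk g : PSL2C))
    fun _ => QuotientGroup.isOpenQuotientMap_mk

/-- The tuple of matrices represents the values of `ρ` at the generators. -/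
def IsLiftOf (φ : FreeGroup ι →* Γ) (A : Tuple ι SL2C) (ρ : RepresentationVariety Γ) : Prop :=
  toPSL A = evalGenerators φ ρ

variable {A B : Tuple ι SL2C} {ρ ρ' : RepresentationVariety Γ}

variable (φ ρ) in
theorem exists_isLiftOf : ∃ A, IsLiftOf φ A ρ := isOpenQuotientMap_toPSL.surjective _

theorem IsLiftOf.unique (hφ : Function.Surjective φ) (h : IsLiftOf φ A ρ) (h' : IsLiftOf φ A ρ') :
    ρ = ρ' :=
  evalGenerators_injective hφ (h.symm.trans h')

theorem IsLiftOf.smul_smul (h : IsLiftOf φ A ρ) (z : CentralTuple ι SL2C) (g : SL2C) :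
    IsLiftOf φ (z • g • A) (conjRep (QuotientGroup.mk g) ρ) := by
  rw [IsLiftOf, ← toPSL_eq_iff.2 ⟨z, rfl⟩]
  funext i
  change (QuotientGroup.mk (g * A i * g⁻¹) : PSL2C) = _
  rw [QuotientGroup.mk_mul, QuotientGroup.mk_mul, QuotientGroup.mk_inv]
  exact congrArg (fun a => QuotientGroup.mk g * a * (QuotientGroup.mk g)⁻¹) (congrFun h i)

theorem isOpen_setOf_exists_isLiftOf (hφ : Function.Surjective φ) {U : Set (Tuple ι SL2C)}
    (hU : IsOpen U) : IsOpen {ρ : RepresentationVariety Γ | ∃ A ∈ U, IsLiftOf φ A ρ} :=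
  (isOpenQuotientMap_toPSL.isOpenMap U hU).preimage (isInducing_evalGenerators hφ).continuous

theorem IsLiftOf.exists_of_mem_closure (hφ : Function.Surjective φ) (hA : IsLiftOf φ A ρ)
    (h : B ∈ closure (centralConjOrbit A)) : ∃ ρ', IsLiftOf φ B ρ' := by
  have hclosed : IsClosed (toPSL ⁻¹' Set.range (evalGenerators φ (G := PSL2C))) :=
    (isClosed_range_evalGenerators hφ).preimage isOpenQuotientMap_toPSL.continuous
  obtain ⟨ρ', hρ'⟩ : B ∈ toPSL ⁻¹' Set.range (evalGenerators φ) := by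
    refine closure_minimal ?_ hclosed h
    rintro _ ⟨z, g, rfl⟩
    exact ⟨_, (hA.smul_smul z g).symm⟩
  exact ⟨ρ', hρ'.symm⟩

theorem mem_closure_conjOrbit_iff (hφ : Function.Surjective φ) (hA : IsLiftOf φ A ρ)
    (hB : IsLiftOf φ B ρ') :
    ρ' ∈ closure (conjOrbit ρ) ↔ B ∈ closure (centralConjOrbit A) := by
  constructor
  · refine fun h => mem_closure_iff.2 fun U hU hBU => ?_
    obtain ⟨_, ⟨C, hCU, hC⟩, ⟨a, rfl⟩⟩ := mem_closure_iff.1 h _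
      (isOpen_setOf_exists_isLiftOf hφ hU) ⟨B, hBU, hB⟩
    obtain ⟨g, rfl⟩ := QuotientGroup.mk_surjective a
    obtain ⟨z, rfl⟩ := toPSL_eq_iff.1 ((hA.smul_smul 1 g).trans hC.symm)
    exact ⟨_, hCU, z, g, by rw [one_smul]⟩
  · intro h
    rw [(isInducing_evalGenerators hφ).closure_eq_preimage_closure_image, Set.mem_preimage,
      ← show toPSL B = _ from hB]
    refine map_mem_closure isOpenQuotientMap_toPSL.continuous h ?_
    rintro _ ⟨z, g, rfl⟩
    exact ⟨_, ⟨QuotientGroup.mk g, rfl⟩, (hA.smul_smul z g).symm⟩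

theorem extendedOrbitEquiv_of_mem_closure (h : ρ' ∈ closure (conjOrbit ρ)) :
    ExtendedOrbitEquiv ρ ρ' :=
  ⟨ρ', h, subset_closure ⟨1, conjRep_one ρ'⟩⟩

end Lifts

section MinimalTuples

variable {ι Γ : Type*} [Fintype ι] [Group Γ] {φ : FreeGroup ι →* Γ}
  {A B X : Tuple ι SL2C} {ρ ρ' : RepresentationVariety Γ} {η η' : CharacterVariety Γ}

theorem IsMinimal.mem_closure_iff_of_extendedOrbitEquiv (hφ : Function.Surjective φ)
    (hA : IsMinimal A) (hX : IsLiftOf φ X ρ) (hB : IsLiftOf φ B ρ')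
    (h : ExtendedOrbitEquiv ρ ρ') :
    A ∈ closure (centralConjOrbit X) ↔ A ∈ closure (centralConjOrbit B) := by
  obtain ⟨τ, hτ, hτ'⟩ := h
  obtain ⟨Y, hY⟩ := exists_isLiftOf φ τ
  rw [mem_closure_conjOrbit_iff hφ hX hY] at hτ
  rw [mem_closure_conjOrbit_iff hφ hB hY] at hτ'
  rw [hA.mem_closure_centralConjOrbit_iff hτ, hA.mem_closure_centralConjOrbit_iff hτ']

theorem IsMinimal.mem_closure_iff_of_toCharacterVariety_eq (hφ : Function.Surjective φ)
    (hA : IsMinimal A) (hX : IsLiftOf φ X ρ) (hB : IsLiftOf φ B ρ')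
    (h : toCharacterVariety ρ = toCharacterVariety ρ') :
    A ∈ closure (centralConjOrbit X) ↔ A ∈ closure (centralConjOrbit B) := by
  have hρ := Quot.eqvGen_exact h
  clear h
  induction hρ generalizing X B with
  | rel ρ ρ' h => exact hA.mem_closure_iff_of_extendedOrbitEquiv hφ hX hB h
  | refl ρ =>
    exact hA.mem_closure_iff_of_extendedOrbitEquiv hφ hX hB
      (extendedOrbitEquiv_of_mem_closure (subset_closure ⟨1, conjRep_one ρ⟩))
  | symm ρ ρ' _ ih => exact (ih hB hX).symm
  | trans ρ τ ρ' _ _ ih ih' =>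
    obtain ⟨Y, hY⟩ := exists_isLiftOf φ τ
    exact (ih hX hY).trans (ih' hY hB)

/-- The minimal tuples that represent a point of the character variety. -/
def minimalTuples (φ : FreeGroup ι →* Γ) (η : CharacterVariety Γ) : Set (Tuple ι SL2C) :=
  {A | IsMinimal A ∧ ∃ ρ, IsLiftOf φ A ρ ∧ toCharacterVariety ρ = η}

theorem mem_minimalTuples_iff (hφ : Function.Surjective φ) (hX : IsLiftOf φ X ρ) :
    A ∈ minimalTuples φ (toCharacterVariety ρ) ↔
      IsMinimal A ∧ A ∈ closure (centralConjOrbit X) := by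
  refine and_congr_right fun hA => ⟨?_, fun h => ?_⟩
  · rintro ⟨ρ', hAρ', hρ'⟩
    exact (hA.mem_closure_iff_of_toCharacterVariety_eq hφ hAρ' hX hρ').1
      (subset_closure (self_mem_centralConjOrbit A))
  · obtain ⟨ρ', hρ'⟩ := hX.exists_of_mem_closure hφ h
    exact ⟨ρ', hρ', (Quot.sound (extendedOrbitEquiv_of_mem_closure
      ((mem_closure_conjOrbit_iff hφ hX hρ').2 h))).symm⟩

theorem minimalTuples_nonempty (hφ : Function.Surjective φ) (η : CharacterVariety Γ) :
    (minimalTuples φ η).Nonempty := by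
  obtain ⟨ρ, rfl⟩ := isQuotientMap_toCharacterVariety.surjective η
  obtain ⟨X, hX⟩ := exists_isLiftOf φ ρ
  obtain ⟨A, hA, hAX, -⟩ := exists_isMinimal_mem_closure X
  exact ⟨A, (mem_minimalTuples_iff hφ hX).2 ⟨hA, hAX⟩⟩

theorem smul_smul_mem_minimalTuples (hφ : Function.Surjective φ) (hA : A ∈ minimalTuples φ η)
    (z : CentralTuple ι SL2C) (k : SU2) : z • k • A ∈ minimalTuples φ η := by
  obtain ⟨hAmin, ρ, hρ, rfl⟩ := hA
  exact (mem_minimalTuples_iff hφ hρ).2 ⟨(hAmin.specialUnitary_smul k).central_smul z,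
    subset_closure ⟨z, k, rfl⟩⟩

theorem exists_smul_smul_eq_of_mem_minimalTuples (hφ : Function.Surjective φ)
    (hA : A ∈ minimalTuples φ η) (hB : B ∈ minimalTuples φ η) :
    ∃ (z : CentralTuple ι SL2C) (k : SU2), z • k • A = B := by
  obtain ⟨hAmin, ρ, hρ, rfl⟩ := hA
  obtain ⟨hBmin, hBA⟩ := (mem_minimalTuples_iff hφ hρ).1 hB
  exact hAmin.exists_smul_smul_eq_of_mem_closure hBmin <|
    mk_mem_closure_setOf_mem_centralConjOrbit
      (subset_closure (subset_closure (self_mem_centralConjOrbit A))) hBA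

theorem eq_of_mem_minimalTuples (hφ : Function.Surjective φ) (h : A ∈ minimalTuples φ η)
    (h' : A ∈ minimalTuples φ η') : η = η' := by
  obtain ⟨-, ρ, hρ, rfl⟩ := h
  obtain ⟨-, ρ', hρ', rfl⟩ := h'
  rw [hρ.unique hφ hρ']

end MinimalTuples

/-! ### Lifting paths of the character variety -/

section CharacterVarietyPaths

instance {ι : Type*} : MulAction (CentralTuple ι SL2C)
    (MulAction.orbitRel.Quotient SU2 (Tuple ι SL2C)) where
  smul z := Quotient.map (z • ·) fun A B ⟨k, hk⟩ =>
    ⟨k, (smul_comm z (k : SL2C) B).symm.trans (congrArg (z • ·) hk)⟩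
  one_smul w := by
    obtain ⟨A, rfl⟩ := toOrbit_surjective w
    exact congrArg (toOrbit SU2) (one_smul (CentralTuple ι SL2C) A)
  mul_smul z z' w := by
    obtain ⟨A, rfl⟩ := toOrbit_surjective w
    exact congrArg (toOrbit SU2) (mul_smul z z' A)

theorem central_smul_toOrbit {ι : Type*} (z : CentralTuple ι SL2C) (A : Tuple ι SL2C) :
    z • toOrbit SU2 A = toOrbit SU2 (z • A) := rfl

instance {ι : Type*} : ContinuousConstSMul (CentralTuple ι SL2C)
    (MulAction.orbitRel.Quotient SU2 (Tuple ι SL2C)) where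
  continuous_const_smul z := continuous_quot_lift _
    (continuous_quot_mk.comp (continuous_const_smul z))

variable {ι Γ : Type*} [Fintype ι] [Group Γ] {φ : FreeGroup ι →* Γ}

theorem upperHemicontinuous_minimalTuples (hφ : Function.Surjective φ) :
    UpperHemicontinuous (minimalTuples φ) := by
  refine upperHemicontinuous_iff_isOpen_preimage_Iic.2 fun U hU => ?_
  rw [← isQuotientMap_toCharacterVariety.isOpen_preimage]
  convert isOpen_setOf_exists_isLiftOf hφ
    (isClosed_setOf_exists_isMinimal_mem_closure hU.isClosed_compl).isOpen_compl using 1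
  ext ρ
  have hiff {X : Tuple ι SL2C} (hX : IsLiftOf φ X ρ) :
      minimalTuples φ (toCharacterVariety ρ) ⊆ U ↔
        ¬ ∃ A ∈ Uᶜ, IsMinimal A ∧ A ∈ closure (centralConjOrbit X) := by
    simp only [← mem_minimalTuples_iff hφ hX, not_exists, not_and, not_imp_not,
      Set.mem_compl_iff, Set.subset_def]
  constructor
  · intro h
    obtain ⟨X, hX⟩ := exists_isLiftOf φ ρ
    exact ⟨X, (hiff hX).1 h, hX⟩
  · rintro ⟨X, h, hX⟩
    exact (hiff hX).2 h

theorem exists_toCharacterVariety_of_toOrbit (hφ : Function.Surjective φ) :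
    ∃ q : MulAction.orbitRel.Quotient SU2 (Tuple ι SL2C) → CharacterVariety Γ,
      ∀ η, ∀ A ∈ minimalTuples φ η, q (toOrbit SU2 A) = η := by
  let f (x : {x : Tuple ι SL2C × CharacterVariety Γ // x.1 ∈ minimalTuples φ x.2}) :=
    toOrbit SU2 x.1.1
  have hfactors : Function.FactorsThrough (fun x => x.1.2) f := fun x y hxy => by
    obtain ⟨k, hk⟩ := toOrbit_eq_iff.1 hxy
    refine eq_of_mem_minimalTuples hφ (A := y.1.1) ?_ y.2
    simpa only [one_smul, hk] using smul_smul_mem_minimalTuples hφ x.2 1 k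
  have : Nonempty (CharacterVariety Γ) := ⟨toCharacterVariety 1⟩
  obtain ⟨q, hq⟩ := (Function.factorsThrough_iff _).1 hfactors
  exact ⟨q, fun η A hA => (congrFun hq ⟨(A, η), hA⟩).symm⟩

theorem isOrbitMapOn_of_minimalTuples (hφ : Function.Surjective φ)
    {q : MulAction.orbitRel.Quotient SU2 (Tuple ι SL2C) → CharacterVariety Γ}
    (hq : ∀ η, ∀ A ∈ minimalTuples φ η, q (toOrbit SU2 A) = η) :
    IsOrbitMapOn (CentralTuple ι SL2C) q (⋃ η, toOrbit SU2 '' minimalTuples φ η) Set.univ := by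
  have hfiber (η : CharacterVariety Γ) : q ⁻¹' {η} ∩ (⋃ η, toOrbit SU2 '' minimalTuples φ η) =
      toOrbit SU2 '' minimalTuples φ η := by
    ext w
    constructor
    · rintro ⟨rfl, hw⟩
      obtain ⟨η', A, hA, rfl⟩ := Set.mem_iUnion.1 hw
      exact ⟨A, by rwa [hq η' A hA], rfl⟩
    · rintro ⟨A, hA, rfl⟩
      exact ⟨hq η A hA, Set.mem_iUnion.2 ⟨η, A, hA, rfl⟩⟩
  constructor <;> simp only [hfiber]
  · exact fun η _ => (minimalTuples_nonempty hφ η).image _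
  · rintro z η - _ ⟨A, hA, rfl⟩
    refine ⟨z • A, ?_, rfl⟩
    simpa only [one_smul] using smul_smul_mem_minimalTuples hφ hA z 1
  · rintro η - _ ⟨A, hA, rfl⟩ _ ⟨B, hB, rfl⟩
    obtain ⟨z, k, rfl⟩ := exists_smul_smul_eq_of_mem_minimalTuples hφ hA hB
    exact ⟨z, by rw [← toOrbit_smul k A, central_smul_toOrbit]⟩
  · refine fun η _ => .of_forall_isOpen fun U hU hηU => ?_
    refine (((upperHemicontinuous_minimalTuples hφ).upperHemicontinuousAt η).forall_isOpen
      (toOrbit SU2 ⁻¹' U) (hU.preimage continuous_quot_mk) (Set.image_subset_iff.1 hηU)).mono ?_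
    exact fun η' => Set.image_subset_iff.2

theorem exists_path_lift {ι Γ : Type*} [Finite ι] [Group Γ] {φ : FreeGroup ι →* Γ}
    (hφ : Function.Surjective φ) {η : ℝ → CharacterVariety Γ} (hη : Continuous η) :
    ∃ ρ : ℝ → RepresentationVariety Γ, Continuous ρ ∧ ∀ t, toCharacterVariety (ρ t) = η t := by
  have := Fintype.ofFinite ι
  obtain ⟨q, hq⟩ := exists_toCharacterVariety_of_toOrbit hφ
  have : T2Space (MulAction.orbitRel.Quotient SU2 (Tuple ι SL2C)) := t2Space_orbitRel_quotient
  obtain ⟨w, hw, hwη⟩ :=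
    (isOrbitMapOn_of_minimalTuples hφ hq).liftsPaths isOpen_univ η hη fun _ => trivial
  obtain ⟨A, hA, hAw⟩ := liftsPaths_toOrbit_SU2 w hw fun _ => trivial
  have hmem (t : ℝ) : A t ∈ minimalTuples φ (η t) := by
    obtain ⟨hqt, ht⟩ := hwη t
    obtain ⟨η', B, hB, hBw⟩ := Set.mem_iUnion.1 ht
    obtain ⟨k, hk⟩ := toOrbit_eq_iff.1 (hBw.trans (hAw t).1.symm)
    obtain rfl : η' = η t := by rw [← hq η' B hB, hBw, hqt]
    simpa only [one_smul, hk] using smul_smul_mem_minimalTuples hφ hB 1 k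
  choose _ ρ hρ hρη using hmem
  refine ⟨ρ, (isInducing_evalGenerators hφ).continuous_iff.2 ?_, hρη⟩
  exact (isOpenQuotientMap_toPSL.continuous.comp hA).congr hρ

end CharacterVarietyPaths

section ConvergentPaths

theorem exists_continuous_ennreal_of_tendsto_atTop {Y : Type*} [TopologicalSpace Y] {f : ℝ≥0 → Y}
    (hf : Continuous f) {y : Y} (hlim : Tendsto f atTop (𝓝 y)) :
    ∃ F : ENNReal → Y, Continuous F ∧ (∀ t : ℝ≥0, F t = f t) ∧ F ⊤ = y := by
  refine ⟨WithTop.recTopCoe y f, continuous_iff_continuousAt.2 fun x => ?_, fun _ => rfl, rfl⟩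
  cases x with
  | coe t => exact ENNReal.isOpenEmbedding_coe.continuousAt_iff.1 hf.continuousAt
  | top =>
    refine tendsto_def.2 fun U (hU : U ∈ 𝓝 y) => ?_
    obtain ⟨a, ha⟩ := eventually_atTop.1 (hlim hU)
    filter_upwards [lt_mem_nhds ENNReal.coe_lt_top] with x (hx : (a : ENNReal) < x)
    cases x with
    | coe t => exact ha t (ENNReal.coe_lt_coe.1 hx).le
    | top => exact show y ∈ U from mem_of_mem_nhds hU

theorem exists_continuous_real_of_tendsto_atTop {Y : Type*} [TopologicalSpace Y] {f : ℝ≥0 → Y}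
    (hf : Continuous f) {y : Y} (hlim : Tendsto f atTop (𝓝 y)) :
    ∃ F : ℝ → Y, Continuous F ∧ (∀ t : ℝ≥0, F (1 + t)⁻¹ = f t) ∧ F 0 = y := by
  obtain ⟨F, hF, hFt, hFtop⟩ := exists_continuous_ennreal_of_tendsto_atTop hf hlim
  refine ⟨fun s => F ((ENNReal.ofReal s)⁻¹ - 1), ?_, fun t => ?_, ?_⟩
  · exact hF.comp ((ENNReal.continuous_sub_right 1).comp
      (continuous_inv.comp ENNReal.continuous_ofReal))
  · have h : (0 : ℝ) < 1 + t := by positivity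
    dsimp only
    rw [ENNReal.ofReal_inv_of_pos h, inv_inv, ENNReal.ofReal_add zero_le_one t.coe_nonneg,
      ENNReal.ofReal_one, ENNReal.ofReal_coe_nnreal, ENNReal.add_sub_cancel_left ENNReal.one_ne_top,
      hFt]
  · simpa using hFtop

end ConvergentPaths

/-! ### Deck groups -/

open scoped Pointwise

section GeneratingSets

theorem closure_setOf_exists_smul_mem_eq_top {G E : Type*} [Group G] [MulAction G E]
    [TopologicalSpace E] [ContinuousConstSMul G E] [PreconnectedSpace E] {U : Set E}
    (hU : IsOpen U) (hne : U.Nonempty) (hcover : ∀ x : E, ∃ g : G, ∃ y ∈ U, g • y = x) :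
    Subgroup.closure {g : G | ∃ x ∈ U, g • x ∈ U} = ⊤ := by
  set H := Subgroup.closure {g : G | ∃ x ∈ U, g • x ∈ U}
  have hH {g h : G} {x y : E} (hx : x ∈ U) (hy : y ∈ U) (hxy : h • x = g • y) (hh : h ∈ H) :
      g ∈ H := by
    have hgh : g⁻¹ * h ∈ H := Subgroup.subset_closure
      ⟨x, hx, by rwa [mul_smul, hxy, inv_smul_smul]⟩
    simpa using mul_mem hh (inv_mem hgh)
  obtain ⟨u, hu⟩ := hne
  refine (Subgroup.eq_top_iff' H).2 fun g => by_contra fun hg => ?_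
  obtain ⟨z, -, ⟨h, hh, x, hx, hxz⟩, ⟨k, hk, y, hy, hyz⟩⟩ := isPreconnected_univ
    ((H : Set G) • U) ((H : Set G)ᶜ • U) hU.smul_left hU.smul_left
    (fun x _ => by
      obtain ⟨k, hk⟩ := hcover x
      exact (em (k ∈ H)).imp (⟨k, ·, hk⟩) (⟨k, ·, hk⟩))
    ⟨u, trivial, 1, one_mem H, u, hu, one_smul G u⟩ ⟨g • u, trivial, g, hg, u, hu, rfl⟩
  exact hk (hH hx hy (hxz.trans hyz.symm) hh)

theorem exists_isCompact_image_interior_eq_univ {S E : Type*} [TopologicalSpace S]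
    [TopologicalSpace E] [CompactSpace S] [WeaklyLocallyCompactSpace E] {p : E → S}
    (hp : IsOpenMap p) (hsurj : Function.Surjective p) :
    ∃ K : Set E, IsCompact K ∧ p '' interior K = Set.univ := by
  choose N hN hNx using fun x : E => exists_compact_mem_nhds x
  obtain ⟨t, ht⟩ := isCompact_univ.elim_finite_subcover (fun x => p '' interior (N x))
    (fun x => hp _ isOpen_interior) fun s _ => by
      obtain ⟨x, rfl⟩ := hsurj s
      exact Set.mem_iUnion.2 ⟨x, x, mem_interior_iff_mem_nhds.2 (hNx x), rfl⟩
  refine ⟨⋃ x ∈ t, N x, t.isCompact_biUnion fun x _ => hN x, Set.univ_subset_iff.1 (ht.trans ?_)⟩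
  exact Set.iUnion₂_subset fun x hx =>
    Set.image_mono (interior_mono (Set.subset_biUnion_of_mem (u := N) hx))

end GeneratingSets

section DeckGroups

variable {S E : Type*} [TopologicalSpace E] {p : E → S}

instance : MulAction (DeckGroup p) E where
  smul γ x := (γ : E ≃ₜ E) x
  one_smul _ := rfl
  mul_smul _ _ _ := rfl

instance : ContinuousConstSMul (DeckGroup p) E where
  continuous_const_smul γ := (γ : E ≃ₜ E).continuous

theorem apply_deckGroup_smul (γ : DeckGroup p) (x : E) : p (γ • x) = p x := γ.2 x

variable [TopologicalSpace S]

theorem eq_of_deckGroup_smul_eq [PreconnectedSpace E] (hp : IsCoveringMap p) {γ γ' : DeckGroup p}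
    {x : E} (h : γ • x = γ' • x) : γ = γ' :=
  Subtype.ext <| DFunLike.coe_injective <| hp.eq_of_comp_eq (γ : E ≃ₜ E).continuous
    (γ' : E ≃ₜ E).continuous (funext fun z => (γ.2 z).trans (γ'.2 z).symm) x h

theorem exists_deckGroup_smul_eq [SimplyConnectedSpace E] [LocallyPathConnectedSpace E]
    (hp : IsCoveringMap p) {x y : E} (h : p x = p y) : ∃ γ : DeckGroup p, γ • x = y := by
  obtain ⟨F, ⟨hF, hpF⟩, -⟩ := hp.existsUnique_continuousMap_lifts ⟨p, hp.continuous⟩ x y h.symm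
  obtain ⟨G, ⟨hG, hpG⟩, -⟩ := hp.existsUnique_continuousMap_lifts ⟨p, hp.continuous⟩ y x h
  have hinv {F G : C(E, E)} {x y : E} (hF : F x = y) (hG : G y = x) (hpF : p ∘ F = p)
      (hpG : p ∘ G = p) : G ∘ F = id :=
    hp.eq_of_comp_eq (G.continuous.comp F.continuous) continuous_id
      (by rw [← Function.comp_assoc, hpG, hpF, Function.comp_id]) x (by simp [hF, hG])
  exact ⟨⟨⟨⟨F, G, congrFun (hinv hF hG hpF hpG), congrFun (hinv hG hF hpG hpF)⟩,
    F.continuous, G.continuous⟩, congrFun hpF⟩, hF⟩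

theorem exists_nhds_subsingleton_deckGroup [T2Space S] [SimplyConnectedSpace E]
    [LocallyPathConnectedSpace E] (hp : IsCoveringMap p) (x y : E) :
    ∃ W ∈ 𝓝 (x, y), {γ : DeckGroup p | ∃ z, (z, γ • z) ∈ W}.Subsingleton := by
  by_cases hxy : p x = p y
  · obtain ⟨γ₀, rfl⟩ := exists_deckGroup_smul_eq hp hxy
    obtain ⟨U, hU, hxU, hinj⟩ := hp.isLocalHomeomorph.isLocallyInjective x
    have hUx : U ∈ 𝓝 x := hU.mem_nhds hxU
    refine ⟨U ×ˢ (γ₀ • U), prod_mem_nhds hUx (smul_mem_nhds_smul γ₀ hUx), ?_⟩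
    suffices h : ∀ γ : DeckGroup p, (∃ z, (z, γ • z) ∈ U ×ˢ (γ₀ • U)) → γ = γ₀ from
      fun γ hγ γ' hγ' => (h γ hγ).trans (h γ' hγ').symm
    rintro γ ⟨z, hz, w, hw, hwz⟩
    obtain rfl : w = z := hinj hw hz <| by
      rw [← apply_deckGroup_smul γ₀ w, ← apply_deckGroup_smul γ z]
      exact congrArg p hwz
    exact (eq_of_deckGroup_smul_eq hp hwz).symm
  · obtain ⟨U, V, hU, hV, hxU, hyV, hUV⟩ := t2_separation hxy
    refine ⟨(p ⁻¹' U) ×ˢ (p ⁻¹' V), prod_mem_nhds ((hU.preimage hp.continuous).mem_nhds hxU)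
      ((hV.preimage hp.continuous).mem_nhds hyV), ?_⟩
    rintro γ ⟨z, hz, hγz⟩
    rw [Set.mem_preimage, apply_deckGroup_smul γ z] at hγz
    exact (hUV.notMem_of_mem_left hz hγz).elim

theorem finite_setOf_exists_deckGroup_smul_mem [T2Space S] [SimplyConnectedSpace E]
    [LocallyPathConnectedSpace E] (hp : IsCoveringMap p) {K : Set E} (hK : IsCompact K) :
    {γ : DeckGroup p | ∃ x ∈ K, γ • x ∈ K}.Finite := by
  have hfinite : {γ : DeckGroup p | ∃ z, (z, γ • z) ∈ K ×ˢ K}.Finite := by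
    refine (hK.prod hK).induction_on (p := fun W => {γ : DeckGroup p | ∃ z, (z, γ • z) ∈ W}.Finite)
      (by simp) (fun W W' h hW' => hW'.subset fun γ ⟨z, hz⟩ => ⟨z, h hz⟩)
      (fun W W' hW hW' => (hW.union hW').subset ?_) fun ⟨x, y⟩ _ => ?_
    · rintro γ ⟨z, hz | hz⟩
      exacts [.inl ⟨z, hz⟩, .inr ⟨z, hz⟩]
    · obtain ⟨W, hW, h⟩ := exists_nhds_subsingleton_deckGroup hp x y
      exact ⟨W, mem_nhdsWithin_of_mem_nhds hW, h.finite⟩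
  exact hfinite

/-- The structure on the source of a local homeomorphism of a space modelled on the target, used to
transfer local properties from the target to the source. -/
abbrev chartedSpaceOfIsLocalHomeomorph (hp : IsLocalHomeomorph p) : ChartedSpace S E where
  atlas := Set.univ
  chartAt x := (hp x).choose
  mem_chart_source x := (hp x).choose_spec.1
  chart_mem_atlas _ := trivial

theorem surjective_of_isCoveringMap [PathConnectedSpace S] [Nonempty E] (hp : IsCoveringMap p) :
    Function.Surjective p := fun s => by
  obtain ⟨x⟩ := ‹Nonempty E›
  let γ := PathConnectedSpace.somePath (p x) s
  obtain ⟨Γ, hΓ, -⟩ := hp.exists_path_lifts γ x γ.source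
  exact ⟨Γ 1, (congrFun hΓ 1).trans γ.target⟩

theorem fg_deckGroup [T2Space S] [CompactSpace S] [ConnectedSpace S] [LocallyPathConnectedSpace S]
    [SimplyConnectedSpace E] (hp : IsCoveringMap p) : Group.FG (DeckGroup p) := by
  let _ := chartedSpaceOfIsLocalHomeomorph hp.isLocalHomeomorph
  have : LocallyPathConnectedSpace E := ChartedSpace.locallyPathConnectedSpace S E
  have : LocallyCompactSpace E := ChartedSpace.locallyCompactSpace S E
  have : PathConnectedSpace S := .of_locallyPathConnectedSpace
  obtain ⟨K, hK, hpK⟩ := exists_isCompact_image_interior_eq_univ hp.isOpenMap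
    (surjective_of_isCoveringMap hp)
  have hcover (x : E) : ∃ γ : DeckGroup p, ∃ y ∈ interior K, γ • y = x := by
    obtain ⟨y, hy, hyx⟩ := hpK.ge (Set.mem_univ (p x))
    obtain ⟨γ, hγ⟩ := exists_deckGroup_smul_eq hp hyx
    exact ⟨γ, y, hy, hγ⟩
  obtain ⟨_, u, hu, -⟩ := hcover (Classical.arbitrary E)
  refine Group.fg_iff.2 ⟨_, closure_setOf_exists_smul_mem_eq_top isOpen_interior ⟨u, hu⟩ hcover,
    (finite_setOf_exists_deckGroup_smul_mem hp hK).subset ?_⟩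
  exact fun γ ⟨x, hx, hγx⟩ => ⟨x, interior_subset hx, interior_subset hγx⟩

end DeckGroups

theorem continuous_holonomy {S E : Type*} [TopologicalSpace E] {p : E → S} :
    Continuous (holonomy (p := p)) :=
  have h : Continuous fun C : DevelopingPair p => (C.dev, C.hol) := continuous_induced_dom
  continuous_quot_lift _ (continuous_quot_mk.comp (continuous_snd.comp h))

end

end NeckPinching

theorem mainTheorem9_general {Γ : Type*} [Group Γ] (hΓ : Group.FG Γ)
    (η : ℝ≥0 → NeckPinching.CharacterVariety Γ) (hη : Continuous η)
    (ηInf : NeckPinching.CharacterVariety Γ) (hlim : Tendsto η atTop (𝓝 ηInf)) :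
    ∃ (ρ : ℝ≥0 → NeckPinching.RepresentationVariety Γ)
      (ρInf : NeckPinching.RepresentationVariety Γ),
      Continuous ρ ∧ (∀ t, NeckPinching.toCharacterVariety (ρ t) = η t) ∧
      Tendsto ρ atTop (𝓝 ρInf) ∧ NeckPinching.toCharacterVariety ρInf = ηInf := by
  obtain ⟨ι, _, φ, hφ⟩ := Group.fg_iff_exists_freeGroup_hom_surjective_finite.1 hΓ
  obtain ⟨F, hF, hFη, hF0⟩ := NeckPinching.exists_continuous_real_of_tendsto_atTop hη hlim
  obtain ⟨ρ, hρ, hρF⟩ := NeckPinching.exists_path_lift hφ hF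
  have hpos (t : ℝ≥0) : 1 + (t : ℝ) ≠ 0 := by positivity
  have hzero : Tendsto (fun t : ℝ≥0 => (1 + (t : ℝ))⁻¹) atTop (𝓝 0) :=
    tendsto_inv_atTop_zero.comp
      (tendsto_atTop_add_const_left _ _ (NNReal.tendsto_coe_atTop.2 tendsto_id))
  refine ⟨fun t => ρ (1 + t)⁻¹, ρ 0, ?_, fun t => by rw [hρF, hFη], (hρ.tendsto 0).comp hzero,
    by rw [hρF, hF0]⟩
  exact hρ.comp ((continuous_const.add NNReal.continuous_coe).inv₀ hpos)

theorem mainTheorem9 {S E : Type*} [TopologicalSpace S] [T2Space S] [CompactSpace S]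
    [ConnectedSpace S] [ChartedSpace (EuclideanSpace ℝ (Fin 2)) S] [IsManifold (𝓡 2) ∞ S]
    (horient : NeckPinching.IsOrientedAtlas S)
    (g : ℕ) (hg : 2 ≤ g) (hgenus : NeckPinching.HasGenus S g)
    [TopologicalSpace E] [SimplyConnectedSpace E] (p : E → S) (hp : IsCoveringMap p)
    (C : ℝ≥0 → NeckPinching.DeformationSpace p) (hC : Continuous C)
    (ηInf : NeckPinching.CharacterVariety (NeckPinching.DeckGroup p))
    (hη : Tendsto (fun t => NeckPinching.holonomy (C t)) atTop (𝓝 ηInf)) :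
    ∃ (ρ : ℝ≥0 → NeckPinching.RepresentationVariety (NeckPinching.DeckGroup p))
      (ρInf : NeckPinching.RepresentationVariety (NeckPinching.DeckGroup p)),
      Continuous ρ ∧
      (∀ t, NeckPinching.toCharacterVariety (ρ t) = NeckPinching.holonomy (C t)) ∧
      Tendsto ρ atTop (𝓝 ρInf) ∧
      NeckPinching.toCharacterVariety ρInf = ηInf := by
  have := ChartedSpace.locallyPathConnectedSpace (EuclideanSpace ℝ (Fin 2)) S
  exact mainTheorem9_general (NeckPinching.fg_deckGroup hp) _
    (NeckPinching.continuous_holonomy.comp hC) ηInf hη
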